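/- Let $q$ be a prime power, $K_\infty=\mathbb F_q((1/\theta))$, and $\mathbb C_\infty$ the completion of an algebraic closure of $K_\infty$, with $|\theta|_\infty=q$. Let $\mathbb T_s$ be the Tate algebra of power series $\sum_\nu a_\nu \underline t^\nu$ in $t_1,\dots,t_s$ over $\mathbb C_\infty$ with $|a_\nu|_\infty\to 0$, equipped with the Gauss norm $\|\sum a_\nu\underline t^\nu\|_\infty=\sup_\nu|a_\nu|_\infty$ and the twist $\tau(\sum a_\nu\underline t^\nu)=\sum a_\nu^q\,\underline t^\nu$; write $f^{(n)}=\tau^n(f)$ for $n\in\mathbb Z$ and $\sigma=\tau^{-1}$; on power series in $z$ over $\mathbb T_s$ and on vectors of such, twists act on the coefficients. Let $\phi\colon \mathbb F_q[\theta,t_1,\dots,t_s]\to\mathbb T_s[\tau]$ be a Drinfeld module of rank $r\ge 1$, i.e. an $\mathbb F_q[t_1,\dots,t_s]$-algebra homomorphism with $$\phi_\theta=\theta+A_1\tau+\dots+A_r\tau^r,$$ and assume $A_r\in\mathbb T_s^\times$. Let $\exp_\phi=\sum_{i\ge0}\alpha_i\tau^i\in\mathbb T_s[[\tau]]$ be the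 unique series with $\alpha_0=1$ and $\exp_\phi a=\phi_a\exp_\phi$ for all $a\in\mathbb F_q[\theta,t_1,\dots,t_s]$, and put $\exp_\phi(f)=\sum_i\alpha_if^{(i)}$ for $f\in\mathbb T_s$. Let $\mathbb T_s[z]$ act on $\mathbb T_s[\sigma]$ by $cz^k\cdot m=c\,m\,(\phi_\theta^*)^k$ ($c\in\mathbb T_s$), where $\phi_\theta^*=\theta+A_1^{(-1)}\sigma+\dots+A_r^{(-r)}\sigma^r$. For $\mathbf h=[h_1,\dots,h_r]\in\mathrm{Mat}_{1\times r}(\mathbb T_s[z])$ put $\iota(\mathbf h)=h_1\cdot 1+h_2\cdot\sigma+\dots+h_r\cdot\sigma^{r-1}$, and let $\Phi\in\mathrm{Mat}_r(\mathbb T_s[z])$ be the matrix with $1$'s directly above the diagonal, last row $$\Bigl[\tfrac{z-\theta}{A_r^{(-r)}},\,-\tfrac{A_1^{(-1)}}{A_r^{(-r)}},\,\dots,\,-\tfrac{A_{r-1}^{(-r+1)}}{A_r^{(-r)}}\Bigr],$$ and zeros elsewhere. Put $\delta_0(\sum a_i\sigma^i)=a_0$ and $\delta_1(\sum a_i\sigma^i)=\sum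 a_i^{(i)}$. Let $\mathbb T_s\{z/\theta\}$ be the set of $\sum a_iz^i\in\mathbb T_s[[z]]$ with $q^i\|a_i\|_\infty\to0$, with norm $\sup_i q^i\|a_i\|_\infty$, and let $D_0\colon\mathrm{Mat}_{1\times r}(\mathbb T_s\{z/\theta\})\to\mathbb T_s$ be the extension by continuity of $\delta_0\circ\iota$ from the dense subset $\mathrm{Mat}_{1\times r}(\mathbb T_s[z])$. Let $\mathbf h\in\mathrm{Mat}_{1\times r}(\mathbb T_s[z])$ and let $\mathbf g\in\mathrm{Mat}_{1\times r}(\mathbb T_s\{z/\theta\})$ satisfy $$\mathbf g^{(-1)}\Phi-\mathbf g=\mathbf h .$$ Then, with $\xi=D_0(\mathbf g+\mathbf h)$ (the limit defining it exists), the series $\exp_\phi(\xi)$ converges and $$\exp_\phi\bigl(D_0(\mathbf g+\mathbf h)\bigr)=\delta_1(\iota(\mathbf h)).$$ -/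

import Mathlib

open Filter Topology
open scoped Polynomial

noncomputable section
namespace DrinfeldTate

/-! ## The field `ℂ_∞` -/
section Cinf
variable (F : Type*) [Field F] [Fintype F]

open Classical in
/-- The absolute value `|·|_∞` on `K = 𝔽_q(θ)`, normalized so that `|θ|_∞ = q`. -/
def inftyAbs : AbsoluteValue (RatFunc F) ℝ where
  toFun f := if f = 0 then 0 else (Fintype.card F : ℝ) ^ f.intDegree
  map_mul' f g := by
    have hq : (Fintype.card F : ℝ) ≠ 0 := by exact_mod_cast Fintype.card_ne_zero
    by_cases hf : f = 0
    · simp [hf]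
    by_cases hg : g = 0
    · simp [hg]
    simp [hf, hg, RatFunc.intDegree_mul hf hg, zpow_add₀ hq]
  nonneg' f := by
    split_ifs <;> positivity
  eq_zero' f := by
    have hq : (Fintype.card F : ℝ) ≠ 0 := by exact_mod_cast Fintype.card_ne_zero
    by_cases hf : f = 0 <;> simp [hf, zpow_ne_zero, hq]
  add_le' f g := by
    have hq : (1 : ℝ) ≤ Fintype.card F := by exact_mod_cast Fintype.card_pos
    have hq0 : (0 : ℝ) < Fintype.card F := by positivity
    by_cases hf : f = 0
    · simp only [hf, zero_add, if_true, le_refl]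
    by_cases hg : g = 0
    · simp only [hg, add_zero, if_true, le_refl]
    by_cases hfg : f + g = 0
    · simp only [hf, hg, hfg, if_true, if_false]; positivity
    simp only [hf, hg, hfg, if_false]
    have h1 := RatFunc.intDegree_add_le hg hfg
    rcases le_max_iff.1 h1 with h | h
    · have := zpow_le_zpow_right₀ hq h
      have h2 : 0 < (Fintype.card F : ℝ) ^ g.intDegree := by positivity
      linarith
    · have := zpow_le_zpow_right₀ hq h
      have h2 : 0 < (Fintype.card F : ℝ) ^ f.intDegree := by positivity
      linarith

theorem inftyAbs_isNonarchimedean : IsNonarchimedean (inftyAbs F) := by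
  intro f g
  have hq : (1 : ℝ) ≤ Fintype.card F := by exact_mod_cast Fintype.card_pos
  have hn := (inftyAbs F).nonneg
  by_cases hf : f = 0
  · simp [hf]
  by_cases hg : g = 0
  · simp [hg]
  by_cases hfg : f + g = 0
  · simp [hfg, hn]
  simp only [inftyAbs, AbsoluteValue.coe_mk, MulHom.coe_mk, hf, hg, hfg, if_false]
  rcases le_max_iff.1 (RatFunc.intDegree_add_le hg hfg) with h | h
  · exact le_max_of_le_left (zpow_le_zpow_right₀ hq h)
  · exact le_max_of_le_right (zpow_le_zpow_right₀ hq h)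

theorem inftyAbs_X : inftyAbs F RatFunc.X = Fintype.card F := by
  simp [inftyAbs, RatFunc.X_ne_zero]

/-- `K_∞ = 𝔽_q((1/θ))`, the completion of `K = 𝔽_q(θ)` at the infinite place. -/
abbrev KInf : Type _ := (inftyAbs F).Completion

/-- The embedding `K → K_∞`. -/
def toKInf : RatFunc F →+* KInf F :=
  UniformSpace.Completion.coeRingHom.comp (WithAbs.equiv (inftyAbs F)).symm.toRingHom

theorem norm_toKInf (f : RatFunc F) : ‖toKInf F f‖ = inftyAbs F f := by
  change ‖((WithAbs.toAbs (inftyAbs F) f : WithAbs (inftyAbs F)) : KInf F)‖ = _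
  rw [UniformSpace.Completion.norm_coe]
  rfl

instance : IsUltrametricDist (KInf F) := by
  refine IsUltrametricDist.isUltrametricDist_of_forall_norm_add_le_max_norm fun x y => ?_
  induction x, y using UniformSpace.Completion.induction_on₂ with
  | hp => exact isClosed_le (by fun_prop) (by fun_prop)
  | ih a b =>
    rw [← UniformSpace.Completion.coe_add]
    simp only [UniformSpace.Completion.norm_coe]
    exact inftyAbs_isNonarchimedean F a.ofAbs b.ofAbs

instance : NontriviallyNormedField (KInf F) where
  non_trivial := ⟨toKInf F RatFunc.X, by
    rw [norm_toKInf, inftyAbs_X]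
    exact_mod_cast Fintype.one_lt_card⟩

/-- An algebraic closure of `K_∞`, with the unique extension of `|·|_∞`. -/
abbrev KInfBar : Type _ := AlgebraicClosure (KInf F)

instance : NormedField (KInfBar F) := spectralNorm.normedField (KInf F) (KInfBar F)

instance : NormedAlgebra (KInf F) (KInfBar F) := spectralNorm.normedAlgebra _ _

instance : IsUltrametricDist (KInfBar F) :=
  IsUltrametricDist.isUltrametricDist_of_forall_norm_add_le_max_norm
    (isNonarchimedean_spectralNorm (K := KInf F) (L := KInfBar F))

instance : NontriviallyNormedField (KInfBar F) where
  non_trivial := by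
    obtain ⟨x, hx⟩ := NontriviallyNormedField.non_trivial (α := KInf F)
    exact ⟨algebraMap _ _ x, by rwa [norm_algebraMap']⟩

/-- `ℂ_∞`, the completion of an algebraic closure of `K_∞`. -/
def CInf : Type _ := UniformSpace.Completion (KInfBar F)

instance : NormedField (CInf F) := inferInstanceAs (NormedField (UniformSpace.Completion (KInfBar F)))

instance : CompleteSpace (CInf F) :=
  inferInstanceAs (CompleteSpace (UniformSpace.Completion (KInfBar F)))

instance : NormedAlgebra (KInf F) (CInf F) :=
  inferInstanceAs (NormedAlgebra (KInf F) (UniformSpace.Completion (KInfBar F)))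

instance : IsUltrametricDist (CInf F) := IsUltrametricDist.of_normedAlgebra (KInf F)

instance : NontriviallyNormedField (CInf F) where
  non_trivial := by
    obtain ⟨x, hx⟩ := NontriviallyNormedField.non_trivial (α := KInf F)
    exact ⟨algebraMap _ _ x, by rwa [norm_algebraMap']⟩

/-- The embedding `K → ℂ_∞`. -/
def toCInf : RatFunc F →+* CInf F := (algebraMap (KInf F) (CInf F)).comp (toKInf F)

theorem norm_toCInf (f : RatFunc F) : ‖toCInf F f‖ = inftyAbs F f := by
  simp [toCInf, norm_toKInf]

instance : Algebra F (CInf F) := ((toCInf F).comp (algebraMap F (RatFunc F))).toAlgebra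

theorem norm_pow_card_sub (a b : CInf F) :
    ‖a ^ Fintype.card F - b ^ Fintype.card F‖ = ‖a - b‖ ^ Fintype.card F := by
  have h := map_sub (FiniteField.frobeniusAlgHom F (CInf F)) a b
  simp only [FiniteField.frobeniusAlgHom_apply] at h
  rw [← h, norm_pow]

theorem pow_card_surjective : Function.Surjective fun a : CInf F => a ^ Fintype.card F := by
  have hind : IsUniformInducing fun a : CInf F => a ^ Fintype.card F := by
    refine Metric.isUniformInducing_iff.2 ⟨?_, fun δ hδ => ?_⟩
    · refine Metric.uniformContinuous_iff.2 fun ε hε => ?_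
      refine ⟨min ε 1, by positivity, fun a b hab => ?_⟩
      rw [dist_eq_norm, norm_pow_card_sub, ← dist_eq_norm]
      have h1 : dist a b < 1 := hab.trans_le (min_le_right _ _)
      exact (pow_le_of_le_one dist_nonneg h1.le Fintype.card_ne_zero).trans_lt
        (hab.trans_le (min_le_left _ _))
    · refine ⟨δ ^ Fintype.card F, by positivity, fun {a b} hab => ?_⟩
      rw [dist_eq_norm, norm_pow_card_sub, ← dist_eq_norm] at hab
      exact lt_of_pow_lt_pow_left₀ _ hδ.le hab
  have hcl := hind.isComplete_range.isClosed
  intro x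
  have hx : x ∈ closure (Set.range fun a : CInf F => a ^ Fintype.card F) := by
    refine closure_mono ?_ (UniformSpace.Completion.denseRange_coe (α := KInfBar F) x)
    rintro _ ⟨y, rfl⟩
    obtain ⟨z, rfl⟩ := IsAlgClosed.exists_pow_nat_eq y (n := Fintype.card F) Fintype.card_pos
    exact ⟨(z : UniformSpace.Completion (KInfBar F)), (map_pow
      (UniformSpace.Completion.coeRingHom (α := KInfBar F)) z _).symm⟩
  rwa [hcl.closure_eq] at hx

/-- The `q`-th power Frobenius automorphism `a ↦ a^q` of `ℂ_∞`. -/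
def frob : CInf F ≃+* CInf F :=
  RingEquiv.ofBijective (FiniteField.frobeniusAlgHom F (CInf F)).toRingHom
    ⟨RingHom.injective _, pow_card_surjective F⟩

theorem frob_apply (a : CInf F) : frob F a = a ^ Fintype.card F := rfl

end Cinf

/-! ## Tate algebras -/
section Tate
variable (F : Type*) [Field F] [Fintype F] (s : ℕ)

/-- The Tate algebra `𝕋_s`: power series in `t_1, …, t_s` over `ℂ_∞` whose coefficients tend to
zero. -/
def Tate : Type _ :=
  MvPowerSeries.IsRestricted.subring (R := CInf F) (σ := Fin s) fun _ => (1 : ℝ)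

instance : CommRing (Tate F s) :=
  inferInstanceAs (CommRing (MvPowerSeries.IsRestricted.subring (R := CInf F) (σ := Fin s)
    fun _ => (1 : ℝ)))

variable {F s}

/-- The coefficient `a_ν` of `f = ∑ a_ν t^ν`. -/
def Tate.coeff (ν : Fin s →₀ ℕ) : Tate F s →+ CInf F :=
  (MvPowerSeries.coeff (R := CInf F) ν).toAddMonoidHom.comp
    (MvPowerSeries.IsRestricted.subring (R := CInf F) (σ := Fin s) fun _ => (1 : ℝ)).subtype.toAddMonoidHom

theorem isRestricted_one_iff {f : MvPowerSeries (Fin s) (CInf F)} :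
    f ∈ MvPowerSeries.IsRestricted.subring (R := CInf F) (σ := Fin s) (fun _ => (1 : ℝ)) ↔
      Tendsto (fun ν => ‖MvPowerSeries.coeff ν f‖) cofinite (𝓝 0) := by
  change MvPowerSeries.IsRestricted _ _ ↔ _
  simp [MvPowerSeries.IsRestricted, Finsupp.prod]

theorem Tate.tendsto_coeff (f : Tate F s) : Tendsto (fun ν => ‖f.coeff ν‖) cofinite (𝓝 0) :=
  isRestricted_one_iff.1 f.2

theorem Tate.ext {f g : Tate F s} (h : ∀ ν, f.coeff ν = g.coeff ν) : f = g :=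
  Subtype.ext (MvPowerSeries.ext h)

theorem Tate.bddAbove (f : Tate F s) : BddAbove (Set.range fun ν => ‖f.coeff ν‖) := by
  have h := f.tendsto_coeff.eventually (gt_mem_nhds zero_lt_one)
  rw [eventually_cofinite] at h
  refine (BddAbove.union (h.image fun ν => ‖f.coeff ν‖).bddAbove (bddAbove_Iic (a := (1 : ℝ)))).mono
    ?_
  rintro _ ⟨ν, rfl⟩
  by_cases hν : ‖f.coeff ν‖ < 1
  · exact Or.inr hν.le
  · exact Or.inl ⟨ν, hν, rfl⟩

/-- `𝕋_s` with the Gauss norm `‖∑ a_ν t^ν‖_∞ = sup_ν |a_ν|_∞`. -/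
instance : NormedAddCommGroup (Tate F s) :=
  AddGroupNorm.toNormedAddCommGroup
    { toFun := fun f => ⨆ ν, ‖f.coeff ν‖
      map_zero' := by simp
      add_le' := fun f g => ciSup_le fun ν => by
        rw [map_add]
        exact (norm_add_le _ _).trans
          (add_le_add (le_ciSup f.bddAbove ν) (le_ciSup g.bddAbove ν))
      neg' := fun f => by simp
      eq_zero_of_map_eq_zero' := fun f hf => Tate.ext fun ν => by
        have h := le_ciSup f.bddAbove ν
        rw [map_zero, ← norm_le_zero_iff]
        exact h.trans hf.le }

theorem Tate.norm_def (f : Tate F s) : ‖f‖ = ⨆ ν, ‖f.coeff ν‖ := rfl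

/-- Scalars `ℂ_∞ → 𝕋_s`. -/
def Tate.const : CInf F →+* Tate F s :=
  MvPowerSeries.C.codRestrict _ fun a => MvPowerSeries.isRestricted_C _ a

theorem Tate.coeff_zero_const (a : CInf F) : (Tate.const a : Tate F s).coeff 0 = a := by
  change MvPowerSeries.coeff (0 : Fin s →₀ ℕ) (MvPowerSeries.C a) = a
  classical
  rw [MvPowerSeries.coeff_C, if_pos rfl]

/-- The variable `t_i` of `𝕋_s`. -/
def Tate.t (i : Fin s) : Tate F s :=
  ⟨MvPowerSeries.X i, MvPowerSeries.isRestricted_monomial _ _ _⟩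

variable (F s) in
/-- The element `θ` of `𝕋_s`. -/
def theta : Tate F s := Tate.const (toCInf F RatFunc.X)

variable (F s) in
/-- The inclusion `𝔽_q[t_1, …, t_s] → 𝕋_s`. -/
def polyToTate : MvPolynomial (Fin s) F →+* Tate F s :=
  MvPolynomial.eval₂Hom (Tate.const.comp (algebraMap F (CInf F))) Tate.t

variable (F s) in
/-- `A[t_1, …, t_s] = 𝔽_q[t_1, …, t_s][θ]`, with `θ` written as the variable `X`. -/
abbrev ATs : Type _ := (MvPolynomial (Fin s) F)[X]

variable (F s) in
/-- The inclusion `A[t_1, …, t_s] → 𝕋_s`. -/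
def atsToTate : ATs F s →+* Tate F s := Polynomial.eval₂RingHom (polyToTate F s) (theta F s)

variable (F s) in
/-- The twisting automorphism `τ (∑ a_ν t^ν) = ∑ a_ν^q t^ν` of `𝕋_s`. -/
def tau : RingAut (Tate F s) where
  toFun f := ⟨MvPowerSeries.map (frob F : CInf F →+* CInf F) f.1, isRestricted_one_iff.2 (by
    have h := f.tendsto_coeff.pow (Fintype.card F)
    rw [zero_pow Fintype.card_ne_zero] at h
    refine h.congr fun ν => ?_
    rw [← norm_pow]
    rfl)⟩
  invFun f := ⟨MvPowerSeries.map ((frob F).symm : CInf F →+* CInf F) f.1,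
    isRestricted_one_iff.2 (by
      have h := f.tendsto_coeff.rpow_const (p := (Fintype.card F : ℝ)⁻¹) (Or.inr (by positivity))
      rw [Real.zero_rpow (by simp)] at h
      refine h.congr fun ν => ?_
      change _ = ‖(frob F).symm (f.coeff ν)‖
      conv_lhs => rw [← (frob F).apply_symm_apply (f.coeff ν), frob_apply, norm_pow]
      exact Real.pow_rpow_inv_natCast (norm_nonneg _) Fintype.card_ne_zero)⟩
  left_inv f := Tate.ext fun ν => (frob F).symm_apply_apply (f.coeff ν)
  right_inv f := Tate.ext fun ν => (frob F).apply_symm_apply (f.coeff ν)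
  map_mul' f g := Subtype.ext (map_mul (MvPowerSeries.map _) f.1 g.1)
  map_add' f g := Subtype.ext (map_add (MvPowerSeries.map _) f.1 g.1)

theorem tau_coeff (f : Tate F s) (ν : Fin s →₀ ℕ) :
    (tau F s f).coeff ν = f.coeff ν ^ Fintype.card F := rfl

theorem tau_const (a : CInf F) :
    tau F s (Tate.const a) = Tate.const (a ^ Fintype.card F) := by
  refine Tate.ext fun ν => ?_
  change MvPowerSeries.coeff ν (MvPowerSeries.C a) ^ _ = MvPowerSeries.coeff ν (MvPowerSeries.C _)
  classical
  rw [MvPowerSeries.coeff_C, MvPowerSeries.coeff_C]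
  split_ifs
  · rfl
  · exact zero_pow Fintype.card_ne_zero

/-- The `n`-fold twist `f^{(n)} = τ^n f`, for `n ∈ ℤ`. -/
def twist (n : ℤ) : RingAut (Tate F s) := tau F s ^ n

/-- The elements of `𝔽_q[t_1, …, t_s]` are fixed by `τ`. -/
theorem tau_polyToTate (a : MvPolynomial (Fin s) F) :
    tau F s (polyToTate F s a) = polyToTate F s a := by
  have : (tau F s : Tate F s →+* Tate F s).comp (polyToTate F s) = polyToTate F s := by
    apply MvPolynomial.ringHom_ext
    · intro c
      simp only [RingHom.comp_apply, polyToTate, MvPolynomial.eval₂Hom_C]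
      exact (tau_const _).trans (by rw [← map_pow, FiniteField.pow_card])
    · intro i
      refine Tate.ext fun ν => ?_
      simp only [RingHom.comp_apply, polyToTate, MvPolynomial.eval₂Hom_X']
      change MvPowerSeries.coeff ν (MvPowerSeries.X i : MvPowerSeries (Fin s) (CInf F)) ^ _ =
        MvPowerSeries.coeff ν (MvPowerSeries.X i : MvPowerSeries (Fin s) (CInf F))
      classical
      rw [MvPowerSeries.coeff_X]
      split_ifs <;> simp
  exact RingHom.congr_fun this a

theorem tau_pow_polyToTate (n : ℕ) (a : MvPolynomial (Fin s) F) :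
    (tau F s ^ n) (polyToTate F s a) = polyToTate F s a := by
  induction n with
  | zero => rfl
  | succ n ih => rw [pow_succ, RingAut.mul_apply, tau_polyToTate, ih]

end Tate

/-! ## Twisted power series and twisted polynomials -/
section Twisted
variable {R : Type*} [CommRing R]

/-- The twisted power series ring `R[[σ]]` for an automorphism `σ` of `R`: series `∑ a_i σ^i` with
the rule `σ a = σ(a) σ`. -/
def TwSeries (_σ : RingAut R) : Type _ := ℕ → R

namespace TwSeries
variable {σ : RingAut R}

instance : AddCommGroup (TwSeries σ) := inferInstanceAs (AddCommGroup (ℕ → R))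

/-- The coefficient of `σ^n`. -/
def coeff (n : ℕ) : TwSeries σ →+ R := Pi.evalAddMonoidHom (fun _ : ℕ => R) n

@[ext] theorem ext {f g : TwSeries σ} (h : ∀ n, f.coeff n = g.coeff n) : f = g := funext h

/-- The series with given coefficients. -/
def mk (a : ℕ → R) : TwSeries σ := a

@[simp] theorem coeff_mk (a : ℕ → R) (n : ℕ) : (mk a : TwSeries σ).coeff n = a n := rfl

instance : One (TwSeries σ) := ⟨mk (Pi.single 0 1)⟩

instance : Mul (TwSeries σ) :=
  ⟨fun f g => mk fun n => ∑ p ∈ Finset.HasAntidiagonal.antidiagonal n, f.coeff p.1 * (σ ^ p.1) (g.coeff p.2)⟩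

theorem coeff_one (n : ℕ) : (1 : TwSeries σ).coeff n = if n = 0 then 1 else 0 := by
  change (Pi.single 0 1 : ℕ → R) n = _
  rw [Pi.single_apply]

theorem coeff_mul (f g : TwSeries σ) (n : ℕ) : (f * g).coeff n =
    ∑ p ∈ Finset.HasAntidiagonal.antidiagonal n, f.coeff p.1 * (σ ^ p.1) (g.coeff p.2) := rfl

instance : Ring (TwSeries σ) :=
  { (inferInstance : AddCommGroup (TwSeries σ)) with
    one_mul := fun f => by
      ext n
      rw [coeff_mul, Finset.sum_eq_single (0, n)]
      · simp [coeff_one]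
      · rintro ⟨i, j⟩ h hne
        have : i ≠ 0 := by
          rintro rfl
          simp_all
        simp [coeff_one, this]
      · simp
    mul_one := fun f => by
      ext n
      rw [coeff_mul, Finset.sum_eq_single (n, 0)]
      · simp [coeff_one]
      · rintro ⟨i, j⟩ h hne
        have : j ≠ 0 := by
          rintro rfl
          simp_all
        simp [coeff_one, this]
      · simp
    zero_mul := fun f => by ext n; simp [coeff_mul]
    mul_zero := fun f => by ext n; simp [coeff_mul]
    left_distrib := fun f g h => by
      ext n; simp [coeff_mul, mul_add, Finset.sum_add_distrib]
    right_distrib := fun f g h => by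
      ext n; simp [coeff_mul, add_mul, Finset.sum_add_distrib]
    mul_assoc := fun f g h => by
      ext n
      simp only [coeff_mul, Finset.sum_mul, Finset.mul_sum, map_sum, Finset.sum_sigma']
      apply Finset.sum_nbij' (fun ⟨⟨_i, j⟩, ⟨k, l⟩⟩ => ⟨(k, l + j), (l, j)⟩)
        (fun ⟨⟨i, _j⟩, ⟨k, l⟩⟩ => ⟨(i + k, l), (i, k)⟩)
      · rintro ⟨⟨i, j⟩, ⟨k, l⟩⟩ h
        simp only [Finset.mem_sigma, Finset.HasAntidiagonal.mem_antidiagonal] at h ⊢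
        exact ⟨by omega, trivial⟩
      · rintro ⟨⟨i, j⟩, ⟨k, l⟩⟩ h
        simp only [Finset.mem_sigma, Finset.HasAntidiagonal.mem_antidiagonal] at h ⊢
        exact ⟨by omega, trivial⟩
      · rintro ⟨⟨i, j⟩, ⟨k, l⟩⟩ h
        simp only [Finset.mem_sigma, Finset.HasAntidiagonal.mem_antidiagonal] at h
        obtain ⟨h1, rfl⟩ := h
        rfl
      · rintro ⟨⟨i, j⟩, ⟨k, l⟩⟩ h
        simp only [Finset.mem_sigma, Finset.HasAntidiagonal.mem_antidiagonal] at h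
        obtain ⟨h1, rfl⟩ := h
        rfl
      · rintro ⟨⟨i, j⟩, ⟨k, l⟩⟩ h
        simp only [Finset.mem_sigma, Finset.HasAntidiagonal.mem_antidiagonal] at h
        obtain ⟨h1, rfl⟩ := h
        simp only [map_mul, pow_add, RingAut.mul_apply, mul_assoc] }

variable (σ) in
/-- The twisted polynomial ring `R[σ]`: the series with finitely many nonzero coefficients. -/
def polySubring : Subring (TwSeries σ) where
  carrier := {f | ∃ N, ∀ n, N ≤ n → f.coeff n = 0}
  zero_mem' := ⟨0, fun n _ => rfl⟩
  one_mem' := ⟨1, fun n hn => by rw [coeff_one, if_neg (by omega)]⟩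
  add_mem' := by
    rintro f g ⟨N, hN⟩ ⟨M, hM⟩
    exact ⟨max N M, fun n hn => by
      rw [map_add, hN n (le_of_max_le_left hn), hM n (le_of_max_le_right hn), add_zero]⟩
  neg_mem' := by
    rintro f ⟨N, hN⟩
    exact ⟨N, fun n hn => by rw [map_neg, hN n hn, neg_zero]⟩
  mul_mem' := by
    rintro f g ⟨N, hN⟩ ⟨M, hM⟩
    refine ⟨N + M, fun n hn => ?_⟩
    rw [coeff_mul]
    refine Finset.sum_eq_zero fun p hp => ?_
    rw [Finset.HasAntidiagonal.mem_antidiagonal] at hp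
    rcases le_or_gt N p.1 with h | h
    · rw [hN _ h, zero_mul]
    · rw [hM p.2 (by omega), map_zero, mul_zero]

end TwSeries

/-- The twisted polynomial ring `R[σ]`. -/
abbrev TwPoly (σ : RingAut R) : Type _ := TwSeries.polySubring σ

namespace TwPoly
variable {σ : RingAut R}

variable (σ) in
/-- Constants `R → R[σ]`. -/
def const : R →+* TwPoly σ where
  toFun a := ⟨TwSeries.mk (Pi.single 0 a), 1, fun n hn => by
    rw [TwSeries.coeff_mk, Pi.single_eq_of_ne (by omega)]⟩
  map_zero' := Subtype.ext (Pi.single_zero (M := fun _ : ℕ => R) 0)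
  map_one' := rfl
  map_add' a b := Subtype.ext (Pi.single_add (f := fun _ : ℕ => R) 0 a b)
  map_mul' a b := Subtype.ext <| TwSeries.ext fun n => by
    change (TwSeries.mk (Pi.single 0 (a * b)) : TwSeries σ).coeff n =
      (TwSeries.mk (Pi.single 0 a) * TwSeries.mk (Pi.single 0 b) : TwSeries σ).coeff n
    rw [TwSeries.coeff_mul]
    simp only [TwSeries.coeff_mk]
    rw [Finset.sum_eq_single_of_mem (0, n) (by simp)]
    · rcases eq_or_ne n 0 with rfl | hn <;> simp [*]
    · rintro ⟨i, j⟩ h hne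
      have : i ≠ 0 := by
        rintro rfl
        simp_all
      simp [this]

variable (σ) in
/-- The element `σ` of `R[σ]`. -/
def gen : TwPoly σ := ⟨TwSeries.mk (Pi.single 1 1), 2, fun n hn => by
  rw [TwSeries.coeff_mk, Pi.single_eq_of_ne (by omega)]⟩

/-- The coefficient of `σ^n`. -/
def coeff (f : TwPoly σ) (n : ℕ) : R := f.1.coeff n

instance : Module R (TwPoly σ) := Module.compHom _ (const σ)

theorem smul_def (a : R) (f : TwPoly σ) : a • f = const σ a * f := rfl

theorem ext {f g : TwPoly σ} (h : ∀ n, f.coeff n = g.coeff n) : f = g :=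
  Subtype.ext (TwSeries.ext h)

@[simp] theorem coeff_const_mul (a : R) (f : TwSeries σ) (n : ℕ) :
    ((const σ a : TwSeries σ) * f).coeff n = a * f.coeff n := by
  rw [TwSeries.coeff_mul, Finset.sum_eq_single_of_mem (0, n) (by simp)]
  · change a * (σ ^ 0) _ = _
    simp
  · rintro ⟨i, j⟩ h hne
    have hi : i ≠ 0 := by
      rintro rfl
      simp_all
    have : (const σ a : TwSeries σ).coeff i = 0 := Pi.single_eq_of_ne (M := fun _ => R) hi a
    simp [this]

@[simp] theorem coeff_mul_const (a : R) (f : TwSeries σ) (n : ℕ) :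
    (f * (const σ a : TwSeries σ)).coeff n = f.coeff n * (σ ^ n) a := by
  rw [TwSeries.coeff_mul, Finset.sum_eq_single_of_mem (n, 0) (by simp)]
  · rfl
  · rintro ⟨i, j⟩ h hne
    have hi : j ≠ 0 := by
      rintro rfl
      simp_all
    have : (const σ a : TwSeries σ).coeff j = 0 := Pi.single_eq_of_ne (M := fun _ => R) hi a
    simp [this]

theorem coeff_gen_pow (j n : ℕ) : (gen σ ^ j).coeff n = if n = j then 1 else 0 := by
  induction j generalizing n with
  | zero => exact TwSeries.coeff_one n
  | succ j ih =>
    rw [pow_succ']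
    change ((gen σ).1 * (gen σ ^ j).1).coeff n = _
    rw [TwSeries.coeff_mul]
    have hg : ∀ i, (gen σ).1.coeff i = if i = 1 then 1 else 0 := fun i =>
      Pi.single_apply (M := R) 1 1 i
    have ih' : ∀ i, (gen σ ^ j).1.coeff i = if i = j then 1 else 0 := ih
    simp only [hg, ih']
    cases n with
    | zero => simp
    | succ n =>
      rw [Finset.sum_eq_single_of_mem (1, n) (by simp [add_comm])]
      · by_cases hn : n = j <;> simp [hn]
      · rintro ⟨i, k⟩ h hne
        have hi : i ≠ 1 := by
          rintro rfl
          simp only [Finset.HasAntidiagonal.mem_antidiagonal] at h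
          exact hne (Prod.ext rfl (by dsimp only; omega))
        simp [hi]

theorem coeff_smul (a : R) (f : TwPoly σ) (n : ℕ) : (a • f).coeff n = a * f.coeff n :=
  coeff_const_mul a f.1 n

theorem coeff_sum {κ : Type*} (t : Finset κ) (f : κ → TwPoly σ) (n : ℕ) :
    (∑ i ∈ t, f i).coeff n = ∑ i ∈ t, (f i).coeff n :=
  map_sum ((TwSeries.coeff n).comp (TwSeries.polySubring σ).subtype.toAddMonoidHom) f t

/-- Right multiplication by `b`, an `R`-linear endomorphism of `R[σ]`. -/
def rightMul (b : TwPoly σ) : Module.End R (TwPoly σ) where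
  toFun m := m * b
  map_add' m n := add_mul m n b
  map_smul' a m := by simp only [smul_def, mul_assoc, RingHom.id_apply]

end TwPoly
end Twisted

/-! ## Drinfeld modules over Tate algebras -/
section Drinfeld
variable (F : Type*) [Field F] [Fintype F] (s : ℕ)

/-- `𝕋_s[τ]` is an `𝔽_q[t_1, …, t_s]`-algebra. -/
instance : Algebra (MvPolynomial (Fin s) F) (TwPoly (tau F s)) :=
  RingHom.toAlgebra' ((TwPoly.const (tau F s)).comp (polyToTate F s)) fun c f =>
    Subtype.ext <| TwSeries.ext fun n => by
      change ((TwPoly.const (tau F s) (polyToTate F s c) : TwSeries (tau F s)) * f.1).coeff n =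
        (f.1 * (TwPoly.const (tau F s) (polyToTate F s c) : TwSeries (tau F s))).coeff n
      rw [TwPoly.coeff_const_mul, TwPoly.coeff_mul_const,
        tau_pow_polyToTate, mul_comm]

/-- A Drinfeld `A[t_1, …, t_s]`-module over `𝕋_s` of rank `r ≥ 1`: an `𝔽_q[t_1, …, t_s]`-algebra
homomorphism `φ : A[t_1, …, t_s] → 𝕋_s[τ]` with `φ_θ = θ + A_1 τ + ⋯ + A_r τ^r`, `A_r ≠ 0`. -/
structure DrinfeldModule (r : ℕ) where
  toAlgHom : ATs F s →ₐ[MvPolynomial (Fin s) F] TwPoly (tau F s)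
  rank_pos : 1 ≤ r
  coeff_zero : (toAlgHom Polynomial.X).coeff 0 = theta F s
  coeff_rank_ne_zero : (toAlgHom Polynomial.X).coeff r ≠ 0
  coeff_eq_zero_of_gt : ∀ i, r < i → (toAlgHom Polynomial.X).coeff i = 0

/-- `𝕋_s[σ]`, where `σ = τ⁻¹`. -/
abbrev SigmaPoly : Type _ := TwPoly (tau F s)⁻¹

variable {F s}

/-- The map `* : 𝕋_s[τ] → 𝕋_s[σ]`, `(∑ f_i τ^i)^* = ∑ f_i^{(-i)} σ^i`. -/
def starMap (f : TwPoly (tau F s)) : SigmaPoly F s :=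
  ⟨TwSeries.mk fun i => twist (-(i : ℤ)) (f.coeff i), by
    obtain ⟨N, hN⟩ := f.2
    exact ⟨N, fun n hn => by
      rw [TwSeries.coeff_mk, TwPoly.coeff, hN n hn, map_zero]⟩⟩

/-- `δ_0 (∑ a_i σ^i) = a_0`. -/
def delta0 (m : SigmaPoly F s) : Tate F s := m.coeff 0

/-- `δ_1 (∑ a_i σ^i) = ∑ a_i^{(i)}`. -/
def delta1 (m : SigmaPoly F s) : Tate F s := ∑ᶠ i : ℕ, twist (i : ℤ) (m.coeff i)

namespace DrinfeldModule
variable {r : ℕ} (φ : DrinfeldModule F s r)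

/-- `φ_θ`. -/
def phiTheta : TwPoly (tau F s) := φ.toAlgHom Polynomial.X

/-- The coefficient `A_i` of `τ^i` in `φ_θ` (so `A_0 = θ`, and `A_i = 0` for `i > r`). -/
def A (i : ℕ) : Tate F s := φ.phiTheta.coeff i

/-! ### The exponential -/

/-- The coefficients `α_i` of the exponential series, given by `α_0 = 1` and
`(θ^{q^n} - θ) α_n = ∑_{i < n} A_{n-i} α_i^{(n-i)}`. -/
def expCoeff : ℕ → Tate F s
  | 0 => 1
  | n + 1 =>
    Tate.const (toCInf F (RatFunc.X ^ Fintype.card F ^ (n + 1) - RatFunc.X))⁻¹ *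
      ∑ i : Fin (n + 1), φ.A (n + 1 - i) * twist (n + 1 - i : ℤ) (expCoeff i)
  decreasing_by exact i.2

/-- The exponential series `exp_φ = ∑ α_i τ^i ∈ 𝕋_s[[τ]]`. -/
def expSeries : TwSeries (tau F s) := TwSeries.mk φ.expCoeff

theorem card_pow_ne (n : ℕ) :
    toCInf F (RatFunc.X ^ Fintype.card F ^ (n + 1) - RatFunc.X) ≠ 0 := by
  rw [map_ne_zero, sub_ne_zero, ← RatFunc.algebraMap_X, ← map_pow]
  intro h
  have h := RatFunc.algebraMap_injective F h
  have h := congrArg Polynomial.natDegree h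
  rw [Polynomial.natDegree_X_pow, Polynomial.natDegree_X] at h
  exact (Nat.one_lt_pow n.succ_ne_zero Fintype.one_lt_card).ne' h

theorem tau_pow_theta (n : ℕ) : (tau F s ^ n) (theta F s) =
    Tate.const (toCInf F (RatFunc.X ^ Fintype.card F ^ n)) := by
  induction n with
  | zero => simp [theta]
  | succ n ih =>
    rw [pow_succ', RingAut.mul_apply, ih, tau_const, ← map_pow, ← pow_mul, pow_succ]

/-- A series `E = ∑ e_i τ^i` with `e_0 = 1` satisfies `E θ = φ_θ E` iff it has the coefficients
above. -/
theorem mul_theta_iff (E : TwSeries (tau F s)) (h0 : E.coeff 0 = 1) :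
    E * (TwPoly.const (tau F s) (theta F s) : TwSeries (tau F s)) = φ.phiTheta.1 * E ↔
      E = φ.expSeries := by
  have key : ∀ n, ((E * (TwPoly.const (tau F s) (theta F s) : TwSeries (tau F s))).coeff (n + 1) =
      (φ.phiTheta.1 * E).coeff (n + 1)) ↔ E.coeff (n + 1) =
        Tate.const (toCInf F (RatFunc.X ^ Fintype.card F ^ (n + 1) - RatFunc.X))⁻¹ *
          ∑ i : Fin (n + 1), φ.A (n + 1 - i) * twist (n + 1 - i : ℤ) (E.coeff i) := by
    intro n
    have hs : (φ.phiTheta.1 * E).coeff (n + 1) = theta F s * E.coeff (n + 1) +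
        ∑ i : Fin (n + 1), φ.A (n + 1 - i) * twist (n + 1 - i : ℤ) (E.coeff i) := by
      rw [TwSeries.coeff_mul, Finset.Nat.sum_antidiagonal_succ]
      congr 1
      · change φ.phiTheta.coeff 0 * _ = _
        rw [phiTheta, φ.coeff_zero]
        simp
      · rw [← Finset.Nat.sum_antidiagonal_swap, Finset.Nat.sum_antidiagonal_eq_sum_range_succ_mk,
          Finset.sum_range]
        refine Finset.sum_congr rfl fun i _ => ?_
        have hi : (i : ℕ) ≤ n := Nat.lt_succ_iff.1 i.2
        have h1 : n + 1 - (i : ℕ) = n - i + 1 := by omega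
        have h2 : (n + 1 - i : ℤ) = ((n - i + 1 : ℕ) : ℤ) := by omega
        rw [h1, h2, twist, zpow_natCast]
        rfl
    rw [TwPoly.coeff_mul_const, tau_pow_theta, hs]
    set S := ∑ i : Fin (n + 1), φ.A (n + 1 - i) * twist (n + 1 - i : ℤ) (E.coeff i)
    set c := toCInf F (RatFunc.X ^ Fintype.card F ^ (n + 1) - RatFunc.X) with hc
    have hc0 : c ≠ 0 := card_pow_ne n
    have h1 : Tate.const (toCInf F (RatFunc.X ^ Fintype.card F ^ (n + 1))) =
        Tate.const c + theta F s := by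
      rw [hc, theta, ← map_add, ← map_add, sub_add_cancel]
    have h2 : (Tate.const c : Tate F s) * Tate.const c⁻¹ = 1 := by
      rw [← map_mul, mul_inv_cancel₀ hc0, map_one]
    rw [h1]
    constructor
    · intro h
      linear_combination (Tate.const c⁻¹) * h - E.coeff (n + 1) * h2
    · intro h
      linear_combination (Tate.const c) * h + S * h2
  constructor
  · intro h
    ext n
    induction n using Nat.strong_induction_on with
    | _ n ih =>
      cases n with
      | zero => rw [h0, expSeries, TwSeries.coeff_mk, expCoeff]
      | succ n =>
        rw [(key n).1 (by rw [h]), expSeries, TwSeries.coeff_mk, expCoeff]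
        congr 1
        refine Finset.sum_congr rfl fun i _ => ?_
        rw [ih i i.2]
        rfl
  · rintro rfl
    ext n
    cases n with
    | zero =>
      rw [TwPoly.coeff_mul_const, TwSeries.coeff_mul]
      simp only [Finset.HasAntidiagonal.antidiagonal_zero, Finset.sum_singleton, pow_zero]
      change _ = φ.phiTheta.coeff 0 * _
      rw [phiTheta, φ.coeff_zero]
      exact mul_comm _ _
    | succ n =>
      rw [key n]
      conv_lhs => rw [expSeries, TwSeries.coeff_mk, expCoeff]
      rfl

/-- `exp_φ` is the unique series with `α_0 = 1` and `exp_φ a = φ_a exp_φ` for all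
`a ∈ A[t_1, …, t_s]`. -/
theorem expSeries_unique (E : TwSeries (tau F s)) :
    (E.coeff 0 = 1 ∧ ∀ a : ATs F s,
      E * (TwPoly.const (tau F s) (atsToTate F s a) : TwSeries (tau F s)) =
        (φ.toAlgHom a).1 * E) ↔ E = φ.expSeries := by
  constructor
  · rintro ⟨h0, h⟩
    rw [← φ.mul_theta_iff E h0]
    simpa [atsToTate, phiTheta] using h Polynomial.X
  · rintro rfl
    have h0 : φ.expSeries.coeff 0 = 1 := by
      rw [expSeries, TwSeries.coeff_mk, expCoeff]
    refine ⟨h0, fun a => ?_⟩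
    have hX := (φ.mul_theta_iff _ h0).2 rfl
    induction a using Polynomial.induction_on' with
    | add p q hp hq =>
      rw [map_add, map_add, map_add, Subring.coe_add, Subring.coe_add, mul_add, add_mul, hp, hq]
    | monomial n c =>
      induction n with
      | zero =>
        rw [Polynomial.monomial_zero_left]
        have h1 : atsToTate F s (Polynomial.C c) = polyToTate F s c := by simp [atsToTate]
        have h2 : φ.toAlgHom (Polynomial.C c) = TwPoly.const (tau F s) (polyToTate F s c) :=
          φ.toAlgHom.commutes c
        rw [h1, h2]
        ext n
        rw [TwPoly.coeff_const_mul, TwPoly.coeff_mul_const, tau_pow_polyToTate, mul_comm]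
      | succ n ih =>
        rw [← Polynomial.monomial_mul_X, map_mul, map_mul, map_mul, Subring.coe_mul,
          Subring.coe_mul, ← mul_assoc, ih, mul_assoc, mul_assoc]
        congr 1
        simpa [atsToTate, phiTheta] using hX

/-- The exponential function `exp_φ : 𝕋_s → 𝕋_s`, `exp_φ(f) = ∑ α_i f^{(i)}`, the sum being taken
with respect to the Gauss norm. -/
def exp (f : Tate F s) : Tate F s := ∑' i : ℕ, φ.expCoeff i * twist (i : ℤ) f

/-! ### The Frobenius module and the standard `z`-frame -/

/-- The action of `𝕋_s[z]` on `H(φ) = 𝕋_s[σ]`: `𝕋_s` acts by left multiplication and `z` acts by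
right multiplication by `φ_θ^*`. -/
def zAct (p : (Tate F s)[X]) (m : SigmaPoly F s) : SigmaPoly F s :=
  Polynomial.aeval (TwPoly.rightMul (starMap φ.phiTheta)) p m

/-- `ι(h) = h_1 · 1 + h_2 · σ + ⋯ + h_r · σ^{r-1}`. -/
def iota (h : Fin r → (Tate F s)[X]) : SigmaPoly F s :=
  ∑ i : Fin r, φ.zAct (h i) (TwPoly.gen _ ^ (i : ℕ))

/-- The matrix `Φ`: ones above the diagonal, last row
`((z - θ)/A_r^{(-r)}, -A_1^{(-1)}/A_r^{(-r)}, …, -A_{r-1}^{(-r+1)}/A_r^{(-r)})`, and zeros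
elsewhere. It is meaningful when `A_r` is a unit. -/
def Phi : Matrix (Fin r) (Fin r) (Tate F s)[X] := Matrix.of fun i j =>
  if (i : ℕ) + 1 = r then
    Polynomial.C (Ring.inverse (twist (-(r : ℤ)) (φ.A r))) *
      if (j : ℕ) = 0 then Polynomial.X - Polynomial.C (theta F s)
      else -Polynomial.C (twist (-(j : ℤ)) (φ.A j))
  else if (j : ℕ) = i + 1 then 1 else 0

/-- `σ p = Φ p` for the basis `p = (1, σ, …, σ^{r-1})` of `H(φ)`. -/
theorem Phi_spec (hA : IsUnit (φ.A r)) (i : Fin r) :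
    TwPoly.gen _ * TwPoly.gen _ ^ (i : ℕ) =
      ∑ j : Fin r, φ.zAct (φ.Phi i j) (TwPoly.gen _ ^ (j : ℕ)) := by
  rw [← pow_succ']
  by_cases hi : (i : ℕ) + 1 = r
  · obtain ⟨u, hu⟩ := hA.map (twist (-(r : ℤ)) : Tate F s ≃+* Tate F s)
    have hz : ∀ j : Fin r, φ.zAct (φ.Phi i j) (TwPoly.gen _ ^ (j : ℕ)) =
        (↑u⁻¹ : Tate F s) • ((if (j : ℕ) = 0 then starMap φ.phiTheta else 0) -
          twist (-(j : ℤ)) (φ.A j) • (TwPoly.gen _ ^ (j : ℕ) : SigmaPoly F s)) := by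
      intro j
      have hinv : Ring.inverse (twist (-(r : ℤ)) (φ.A r)) = (↑u⁻¹ : Tate F s) := by
        rw [← Ring.inverse_unit u, hu]
      simp only [Phi, Matrix.of_apply, hi, if_true, hinv]
      by_cases hj : (j : ℕ) = 0
      · have hA0 : φ.A 0 = theta F s := φ.coeff_zero
        simp only [hj, if_true, zAct, map_mul, map_sub, Polynomial.aeval_C, Polynomial.aeval_X,
          Module.End.mul_apply, Module.algebraMap_end_apply, LinearMap.sub_apply, hA0, pow_zero,
          Nat.cast_zero, neg_zero, twist, zpow_zero, RingAut.one_apply]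
        rw [TwPoly.rightMul, ← smul_sub]
        simp [smul_sub]
      · simp only [hj, if_false, zAct, map_mul, map_neg, Polynomial.aeval_C,
          Module.End.mul_apply, Module.algebraMap_end_apply, LinearMap.neg_apply, zero_sub,
          smul_neg]
    rw [Finset.sum_congr rfl fun j _ => hz j, ← Finset.smul_sum, Finset.sum_sub_distrib]
    have h1 : ∑ j : Fin r, (if (j : ℕ) = 0 then starMap φ.phiTheta else 0) = starMap φ.phiTheta := by
      rw [Finset.sum_eq_single ⟨0, φ.rank_pos⟩] <;> simp +contextual [Fin.ext_iff]
    have h2 : starMap φ.phiTheta = ∑ j : Fin r,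
        twist (-(j : ℤ)) (φ.A j) • (TwPoly.gen _ ^ (j : ℕ) : SigmaPoly F s) +
          (u : Tate F s) • TwPoly.gen _ ^ r := by
      rw [hu]
      rw [Fin.sum_univ_eq_sum_range (fun j : ℕ => twist (-(j : ℤ)) (φ.A j) •
        (TwPoly.gen _ ^ (j : ℕ) : SigmaPoly F s)), ← Finset.sum_range_succ]
      refine TwPoly.ext fun n => ?_
      rw [TwPoly.coeff_sum]
      simp only [TwPoly.coeff_smul, TwPoly.coeff_gen_pow]
      have h3 : (starMap φ.phiTheta).coeff n = twist (-(n : ℤ)) (φ.A n) := rfl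
      rw [h3]
      by_cases hn : n ∈ Finset.range (r + 1)
      · simp [hn]
      · rw [Finset.mem_range, not_lt] at hn
        have h4 : φ.A n = 0 := φ.coeff_eq_zero_of_gt n hn
        rw [h4, map_zero, Finset.sum_eq_zero]
        intro j hj
        rw [if_neg, mul_zero]
        rintro rfl
        simp at hj
        omega
    rw [h1, h2, add_sub_cancel_left, smul_smul, Units.inv_mul, one_smul, hi]
  · have hlt : (i : ℕ) + 1 < r := lt_of_le_of_ne i.2 hi
    rw [Finset.sum_eq_single ⟨i + 1, hlt⟩]
    · simp [Phi, hi, zAct]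
    · intro j _ hj
      have : (j : ℕ) ≠ i + 1 := fun h => hj (Fin.ext h)
      simp [Phi, hi, zAct, this]
    · simp

end DrinfeldModule

/-! ### The ring `𝕋_s{z/θ}` and the map `D_0` -/

variable (F s) in
/-- `𝕋_s{z/θ}`: power series `∑ a_i z^i` over `𝕋_s` with `‖θ‖^i ‖a_i‖ → 0`. -/
def tateDisk : AddSubgroup (PowerSeries (Tate F s)) where
  carrier := {f | Tendsto (fun i => ‖theta F s‖ ^ i * ‖PowerSeries.coeff i f‖) atTop (𝓝 0)}
  zero_mem' := by simp
  add_mem' := by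
    intro f g hf hg
    refine squeeze_zero (fun i => by positivity) (fun i => ?_) (by simpa using hf.add hg)
    rw [← mul_add, map_add]
    gcongr
    exact norm_add_le _ _
  neg_mem' := by
    intro f hf
    simpa using hf

theorem theta_norm_pos : 0 < ‖theta F s‖ := by
  rw [norm_pos_iff, theta]
  intro h
  have h := congrArg (Tate.coeff 0) h
  rw [map_zero] at h
  rw [Tate.coeff_zero_const] at h
  exact RatFunc.X_ne_zero ((map_eq_zero _).1 h)

theorem tateDisk_bddAbove (f : tateDisk F s) :
    BddAbove (Set.range fun i => ‖theta F s‖ ^ i * ‖PowerSeries.coeff i f.1‖) :=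
  f.2.bddAbove_range

/-- The norm `‖∑ a_i z^i‖_θ = sup_i ‖θ‖^i ‖a_i‖` on `𝕋_s{z/θ}`. -/
instance : NormedAddCommGroup (tateDisk F s) :=
  AddGroupNorm.toNormedAddCommGroup
    { toFun := fun f => ⨆ i, ‖theta F s‖ ^ i * ‖PowerSeries.coeff i f.1‖
      map_zero' := by simp
      add_le' := fun f g => ciSup_le fun i => by
        refine le_trans ?_ (add_le_add (le_ciSup (tateDisk_bddAbove f) i)
          (le_ciSup (tateDisk_bddAbove g) i))
        rw [← mul_add]
        gcongr
        exact norm_add_le _ _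
      neg' := fun f => by simp
      eq_zero_of_map_eq_zero' := fun f hf => Subtype.ext <| PowerSeries.ext fun i => by
        have h := (le_ciSup (tateDisk_bddAbove f) i).trans hf.le
        have h' := nonpos_of_mul_nonpos_right h (pow_pos theta_norm_pos i)
        simpa using h' }

/-- The inclusion `𝕋_s[z] → 𝕋_s{z/θ}`. -/
def polyToDisk (p : (Tate F s)[X]) : tateDisk F s :=
  ⟨(p : PowerSeries (Tate F s)), by
    refine tendsto_nhds_of_eventually_eq ?_
    filter_upwards [eventually_gt_atTop p.natDegree] with i hi
    rw [Polynomial.coeff_coe, Polynomial.coeff_eq_zero_of_natDegree_lt hi, norm_zero, mul_zero]⟩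

/-- The inclusion of row vectors `Mat_{1×r}(𝕋_s[z]) → Mat_{1×r}(𝕋_s{z/θ})`, where the target
carries the maximum of the norms `‖·‖_θ` of the entries. -/
def vecToDisk {r : ℕ} (h : Fin r → (Tate F s)[X]) : Fin r → tateDisk F s :=
  fun i => polyToDisk (h i)

theorem denseRange_vecToDisk {r : ℕ} :
    DenseRange (vecToDisk : (Fin r → (Tate F s)[X]) → Fin r → tateDisk F s) := by
  have h1 : DenseRange (polyToDisk : (Tate F s)[X] → tateDisk F s) := by
    intro f
    refine Metric.mem_closure_range_iff.2 fun ε hε => ?_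
    obtain ⟨N, hN⟩ := eventually_atTop.1 (f.2.eventually (gt_mem_nhds (half_pos hε)))
    refine ⟨PowerSeries.trunc N f.1, lt_of_le_of_lt ?_ (half_lt_self hε)⟩
    rw [dist_eq_norm]
    refine ciSup_le fun i => ?_
    change _ * ‖PowerSeries.coeff i (f.1 - (PowerSeries.trunc N f.1 : PowerSeries (Tate F s)))‖ ≤ _
    rw [map_sub, Polynomial.coeff_coe, PowerSeries.coeff_trunc]
    split_ifs with h
    · rw [sub_self, norm_zero, mul_zero]
      exact (half_pos hε).le
    · rw [sub_zero]
      exact (hN i (not_lt.1 h)).le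
  exact DenseRange.piMap fun _ => h1

namespace DrinfeldModule
variable {r : ℕ} (φ : DrinfeldModule F s r)

/-- `D_0`, the extension of `δ_0 ∘ ι` by continuity from `Mat_{1×r}(𝕋_s[z])` to
`Mat_{1×r}(𝕋_s{z/θ})`: the limit of `δ_0(ι(h))` as the polynomial vector `h` tends to `g`. -/
def D0 (g : Fin r → tateDisk F s) : Tate F s :=
  limUnder (comap vecToDisk (𝓝 g)) fun h => delta0 (φ.iota h)

end DrinfeldModule
end Drinfeld
end DrinfeldTate

end

open DrinfeldTate

/-! Write g = Σ g_k z^k and let h_n be the vector P^{(-1)} Φ - P attached to the tail P = Σ_{k ≥ n}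
g_k z^{k-n}. It is polynomial because h is and Φ is linear in z, and h_0 = h. Splitting off the
constant term of the tail gives z h_{n+1} + g_n^{(-1)} Φ = h_n + g_n
(`IsSolution.X_mul_divided_succ`), an identity that is read in two ways.

Under δ_1 ∘ ι, multiplication by z becomes right multiplication by φ_θ^*, which δ_1 turns into the
operator φ_θ, while g_n^{(-1)} Φ becomes σ ι(g_n), which δ_1 does not distinguish from ι(g_n). Hence
d_n = δ_1(ι(h_n)) satisfies φ_θ(d_{n+1}) = d_n. On the other hand δ_0 ∘ ι is evaluation of the first
entry at z = θ, where the first column of Φ vanishes. So θ^n times the first entry of h_n at θ is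
that of h plus the n-th partial sum of the first entry of g, and it tends to ξ. For large n the
vector h_n is a constant in its first entry and zero elsewhere, so this value is d_n itself and θ^n
d_n → ξ.

The elements exp_φ(θ^{-n} ξ) form another tower under φ_θ with the same asymptotics
(`exp_theta_mul`, `exp_approx`). Such a tower is unique (`eq_zero_of_phiAct_tower`): near 0 the
operator φ_θ expands norms by at most q, so for the difference x_n of the two towers q^n ‖x_n‖ is
eventually nondecreasing, yet it tends to 0. Thus x_n = 0 for large n, and applying φ_θ carries this
down to n = 0, which is the formula. -/

noncomputable section
namespace DrinfeldTate

variable {F : Type*} [Field F] [Fintype F] {s : ℕ}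

/-! ## Analysis in the Tate algebra -/

namespace Tate

theorem norm_coeff_le (f : Tate F s) (ν : Fin s →₀ ℕ) : ‖f.coeff ν‖ ≤ ‖f‖ :=
  le_ciSup f.bddAbove ν

theorem norm_le {f : Tate F s} {C : ℝ} (h : ∀ ν, ‖f.coeff ν‖ ≤ C) : ‖f‖ ≤ C :=
  ciSup_le h

instance : IsUltrametricDist (Tate F s) :=
  IsUltrametricDist.isUltrametricDist_of_forall_norm_add_le_max_norm fun f g =>
    norm_le fun ν => by
      rw [map_add]
      exact (IsUltrametricDist.norm_add_le_max _ _).trans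
        (max_le_max (norm_coeff_le f ν) (norm_coeff_le g ν))

theorem coeff_mul [DecidableEq (Fin s)] (f g : Tate F s) (ν : Fin s →₀ ℕ) :
    (f * g).coeff ν = ∑ p ∈ Finset.HasAntidiagonal.antidiagonal ν, f.coeff p.1 * g.coeff p.2 :=
  MvPowerSeries.coeff_mul ν f.1 g.1

theorem norm_mul_le' (f g : Tate F s) : ‖f * g‖ ≤ ‖f‖ * ‖g‖ := by
  classical
  refine norm_le fun ν => ?_
  rw [coeff_mul]
  refine IsUltrametricDist.norm_sum_le_of_forall_le_of_nonneg (by positivity) fun p _ => ?_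
  rw [norm_mul]
  gcongr
  · exact norm_coeff_le f _
  · exact norm_coeff_le g _

/-- The Gauss norm makes `𝕋_s` a normed ring. -/
abbrev normedCommRing : NormedCommRing (Tate F s) :=
  { (inferInstance : NormedAddCommGroup (Tate F s)), (inferInstance : CommRing (Tate F s)) with
    norm_mul_le := norm_mul_le' }

attribute [local instance] normedCommRing

theorem norm_const (a : CInf F) : ‖(const a : Tate F s)‖ = ‖a‖ := by
  classical
  refine le_antisymm (norm_le fun ν => ?_) ?_
  · change ‖MvPowerSeries.coeff ν (MvPowerSeries.C a)‖ ≤ _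
    rw [MvPowerSeries.coeff_C]
    split_ifs <;> simp
  · conv_lhs => rw [← coeff_zero_const (s := s) a]
    exact norm_coeff_le _ _

instance : NormOneClass (Tate F s) where
  norm_one := by rw [← map_one const, norm_const, norm_one]

/-- A nonzero constant is a unit whose inverse has the inverse norm, so submultiplicativity applied
to both gives equality; the full Gauss lemma is not needed. -/
theorem norm_const_mul (a : CInf F) (f : Tate F s) : ‖const a * f‖ = ‖a‖ * ‖f‖ := by
  rcases eq_or_ne a 0 with rfl | ha
  · simp
  refine le_antisymm ((norm_mul_le _ _).trans_eq (by rw [norm_const])) ?_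
  have h : f = const a⁻¹ * (const a * f) := by
    rw [← mul_assoc, ← map_mul, inv_mul_cancel₀ ha, map_one, one_mul]
  have h1 : ‖f‖ ≤ ‖a‖⁻¹ * ‖const a * f‖ := by
    conv_lhs => rw [h]
    exact (norm_mul_le _ _).trans_eq (by rw [norm_const, norm_inv])
  rwa [le_inv_mul_iff₀ (norm_pos_iff.2 ha)] at h1

/-- Limits are taken coefficientwise. The Gauss norm makes the convergence uniform in ν, which is
what forces the limit coefficients to tend to zero. -/
instance : CompleteSpace (Tate F s) := by
  refine Metric.complete_of_cauchySeq_tendsto fun u hu => ?_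
  have hc : ∀ ν, CauchySeq fun n => (u n).coeff ν := fun ν => by
    refine Metric.cauchySeq_iff'.2 fun ε hε => ?_
    obtain ⟨N, hN⟩ := Metric.cauchySeq_iff'.1 hu ε hε
    refine ⟨N, fun n hn => lt_of_le_of_lt ?_ (hN n hn)⟩
    rw [dist_eq_norm, dist_eq_norm, ← map_sub]
    exact norm_coeff_le _ _
  choose a ha using fun ν => cauchySeq_tendsto_of_complete (hc ν)
  have hunif : ∀ ε > 0, ∃ N, ∀ n ≥ N, ∀ ν, ‖(u n).coeff ν - a ν‖ ≤ ε := by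
    intro ε hε
    obtain ⟨N, hN⟩ := Metric.cauchySeq_iff.1 hu ε hε
    refine ⟨N, fun n hn ν => ?_⟩
    refine le_of_tendsto ((tendsto_const_nhds.sub (ha ν)).norm) ?_
    filter_upwards [eventually_ge_atTop N] with m hm
    rw [← map_sub]
    refine (norm_coeff_le _ _).trans ?_
    rw [← dist_eq_norm]
    exact (hN n hn m hm).le
  obtain ⟨l, hl⟩ : ∃ l : Tate F s, ∀ ν, l.coeff ν = a ν := by
    refine ⟨⟨fun ν => a ν, isRestricted_one_iff.2 (Metric.tendsto_nhds.2 fun ε hε => ?_)⟩,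
      fun _ => rfl⟩
    obtain ⟨N, hN⟩ := hunif (ε / 2) (half_pos hε)
    filter_upwards [(u N).tendsto_coeff.eventually (gt_mem_nhds (half_pos hε))] with ν hν
    rw [dist_zero_right, norm_norm]
    change ‖a ν‖ < ε
    have h1 : a ν = (u N).coeff ν - ((u N).coeff ν - a ν) := by abel
    rw [h1]
    exact (norm_sub_le _ _).trans_lt (by linarith [hN N le_rfl ν])
  refine ⟨l, Metric.tendsto_atTop.2 fun ε hε => ?_⟩
  obtain ⟨N, hN⟩ := hunif (ε / 2) (half_pos hε)
  refine ⟨N, fun n hn => lt_of_le_of_lt ?_ (half_lt_self hε)⟩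
  rw [dist_eq_norm]
  exact Tate.norm_le fun ν => by
    rw [map_sub, hl]
    exact hN n hn ν

end Tate

attribute [local instance] Tate.normedCommRing

/-! ### Norms of θ and of twists -/

theorem norm_theta : ‖theta F s‖ = Fintype.card F := by
  rw [theta, Tate.norm_const, norm_toCInf, inftyAbs_X]

theorem norm_tau (f : Tate F s) : ‖tau F s f‖ = ‖f‖ ^ Fintype.card F := by
  refine le_antisymm (Tate.norm_le fun ν => ?_) ?_
  · rw [tau_coeff, norm_pow]
    gcongr
    exact Tate.norm_coeff_le f ν
  -- The supremum is compared through q-th roots, so that each coefficient of f is bounded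
  -- separately.
  · have h : ‖f‖ ≤ ‖tau F s f‖ ^ ((Fintype.card F : ℝ)⁻¹) := by
      refine Tate.norm_le fun ν => ?_
      rw [← Real.pow_rpow_inv_natCast (norm_nonneg (f.coeff ν)) (Fintype.card_ne_zero (α := F)),
        ← norm_pow, ← tau_coeff]
      gcongr
      exact Tate.norm_coeff_le _ ν
    calc ‖f‖ ^ Fintype.card F ≤ (‖tau F s f‖ ^ ((Fintype.card F : ℝ)⁻¹)) ^ Fintype.card F := by
          gcongr
      _ = _ := Real.rpow_inv_natCast_pow (norm_nonneg _) Fintype.card_ne_zero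

theorem twist_natCast (n : ℕ) : twist (F := F) (s := s) (n : ℤ) = tau F s ^ n :=
  zpow_natCast _ _

theorem norm_twist (n : ℕ) (f : Tate F s) :
    ‖twist (n : ℤ) f‖ = ‖f‖ ^ Fintype.card F ^ n := by
  rw [twist_natCast]
  induction n with
  | zero => simp
  | succ n ih => rw [pow_succ', RingAut.mul_apply, norm_tau, ih, ← pow_mul, pow_succ]

theorem twist_add (m n : ℤ) (f : Tate F s) : twist (m + n) f = twist m (twist n f) := by
  rw [twist, zpow_add, RingAut.mul_apply]; rfl

theorem twist_zero (f : Tate F s) : twist 0 f = f := by simp [twist]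

theorem continuous_twist (n : ℕ) : Continuous (twist (n : ℤ) : Tate F s → Tate F s) := by
  rw [continuous_iff_continuousAt]
  intro f
  rw [ContinuousAt, tendsto_iff_norm_sub_tendsto_zero]
  have h : Tendsto (fun g : Tate F s => ‖g - f‖ ^ Fintype.card F ^ n) (𝓝 f) (𝓝 0) := by
    have h1 := (tendsto_iff_norm_sub_tendsto_zero.1 (tendsto_id (x := 𝓝 f))).pow
      (Fintype.card F ^ n)
    rwa [zero_pow (pow_ne_zero _ Fintype.card_ne_zero)] at h1
  exact h.congr fun g => by rw [← map_sub, norm_twist]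

/-- Inverse of `θ` in `𝕋_s`. -/
def thetaInv (F : Type*) [Field F] [Fintype F] (s : ℕ) : Tate F s :=
  Tate.const (toCInf F RatFunc.X)⁻¹

theorem theta_mul_thetaInv : theta F s * thetaInv F s = 1 := by
  rw [theta, thetaInv, ← map_mul, mul_inv_cancel₀, map_one]
  rw [map_ne_zero]
  exact RatFunc.X_ne_zero

theorem norm_thetaInv : ‖thetaInv F s‖ = (Fintype.card F : ℝ)⁻¹ := by
  rw [thetaInv, Tate.norm_const, norm_inv, norm_toCInf, inftyAbs_X]

namespace DrinfeldModule
variable {r : ℕ} (φ : DrinfeldModule F s r)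

/-! ## The operator `φ_θ` and the exponential -/

theorem A_zero : φ.A 0 = theta F s := φ.coeff_zero

theorem A_eq_zero {i : ℕ} (hi : r < i) : φ.A i = 0 := φ.coeff_eq_zero_of_gt i hi

theorem exists_norm_A_le : ∃ B : ℝ, 1 ≤ B ∧ ∀ i, ‖φ.A i‖ ≤ B := by
  refine ⟨1 + ∑ i ∈ Finset.range (r + 1), ‖φ.A i‖, ?_, fun i => ?_⟩
  · linarith [Finset.sum_nonneg fun i (_ : i ∈ Finset.range (r + 1)) => norm_nonneg (φ.A i)]
  · rcases le_or_gt i r with h | h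
    · have := Finset.single_le_sum (fun i _ => norm_nonneg (φ.A i))
        (Finset.mem_range.2 (Nat.lt_succ_of_le h))
      linarith
    · rw [φ.A_eq_zero h, norm_zero]
      exact add_nonneg zero_le_one (Finset.sum_nonneg fun i _ => norm_nonneg _)

/-- The action of `φ_θ` on `𝕋_s`. -/
def phiAct : Tate F s →+ Tate F s where
  toFun f := ∑ j ∈ Finset.range (r + 1), φ.A j * twist (j : ℤ) f
  map_zero' := by simp
  map_add' f g := by simp [mul_add, Finset.sum_add_distrib]

theorem phiAct_apply (f : Tate F s) :
    φ.phiAct f = ∑ j ∈ Finset.range (r + 1), φ.A j * twist (j : ℤ) f := rfl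

/-- The terms with j ≥ 1 are of order at least 2 in f, so on a small ball they are dominated by the
linear term θ f, of norm q ‖f‖. -/
theorem exists_norm_phiAct_le : ∃ ε : ℝ, 0 < ε ∧ ∀ f : Tate F s, ‖f‖ ≤ ε →
    ‖φ.phiAct f‖ ≤ Fintype.card F * ‖f‖ := by
  obtain ⟨B, hB1, hB⟩ := φ.exists_norm_A_le
  have hB0 : 0 < B := zero_lt_one.trans_le hB1
  have hq : (1 : ℝ) ≤ Fintype.card F := by exact_mod_cast Fintype.card_pos
  -- The radius 1/B gives B ‖f‖ ≤ 1, and B ≥ 1 gives ‖f‖ ≤ 1, so that higher powers of ‖f‖ are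
  -- bounded by its square.
  refine ⟨B⁻¹, inv_pos.2 hB0, fun f hf => ?_⟩
  rw [phiAct_apply]
  refine IsUltrametricDist.norm_sum_le_of_forall_le_of_nonneg (by positivity) fun j _ => ?_
  refine (norm_mul_le _ _).trans ?_
  rw [norm_twist]
  rcases Nat.eq_zero_or_pos j with rfl | hj
  · rw [A_zero, norm_theta, pow_zero, pow_one]
  have hf1 : ‖f‖ ≤ 1 := hf.trans (inv_le_one_of_one_le₀ hB1)
  have h2 : 2 ≤ Fintype.card F ^ j := by
    have := Nat.one_lt_pow hj.ne' (Fintype.one_lt_card (α := F))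
    omega
  calc ‖φ.A j‖ * ‖f‖ ^ Fintype.card F ^ j ≤ B * ‖f‖ ^ 2 := by
        exact mul_le_mul (hB j) (pow_le_pow_of_le_one (norm_nonneg _) hf1 h2) (by positivity) hB0.le
    _ = (B * ‖f‖) * ‖f‖ := by ring
    _ ≤ 1 * ‖f‖ := by
        gcongr
        calc B * ‖f‖ ≤ B * B⁻¹ := by gcongr
          _ = 1 := mul_inv_cancel₀ hB0.ne'
    _ ≤ _ := by gcongr

/-! ### Decay of the coefficients of exp_φ -/

theorem norm_card_pow (n : ℕ) :
    ‖toCInf F (RatFunc.X ^ Fintype.card F ^ (n + 1) - RatFunc.X)‖ =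
      (Fintype.card F : ℝ) ^ Fintype.card F ^ (n + 1) := by
  have hq : (1 : ℝ) < Fintype.card F := by exact_mod_cast Fintype.one_lt_card
  have h1 : ‖toCInf F RatFunc.X‖ < ‖toCInf F (RatFunc.X ^ Fintype.card F ^ (n + 1))‖ := by
    rw [map_pow, norm_pow, norm_toCInf, inftyAbs_X]
    exact lt_self_pow₀ hq (Nat.one_lt_pow n.succ_ne_zero Fintype.one_lt_card)
  rw [map_sub, sub_eq_add_neg, IsUltrametricDist.norm_add_eq_max_of_norm_ne_norm
    (by rw [norm_neg]; exact h1.ne'), norm_neg, max_eq_left h1.le, map_pow, norm_pow, norm_toCInf,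
    inftyAbs_X]

/-- In the recursion, twisting by n + 1 - i turns a bound S^{q^i} into S^{q^{n+1}}, and the
denominator contributes q^{-q^{n+1}}. Only the r preceding coefficients need a bound, since A_j = 0
for j > r. -/
theorem norm_expCoeff_succ_le {B : ℝ} (hB0 : 0 ≤ B) (hB : ∀ i, ‖φ.A i‖ ≤ B) {S : ℝ} (hS : 0 ≤ S)
    (n : ℕ) (h : ∀ i ≤ n, n + 1 ≤ i + r → ‖φ.expCoeff i‖ ≤ S ^ Fintype.card F ^ i) :
    ‖φ.expCoeff (n + 1)‖ ≤ B * (S / Fintype.card F) ^ Fintype.card F ^ (n + 1) := by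
  rw [expCoeff, Tate.norm_const_mul, norm_inv, norm_card_pow, div_pow, mul_div_assoc',
    inv_mul_eq_div]
  gcongr
  refine IsUltrametricDist.norm_sum_le_of_forall_le_of_nonneg (by positivity) fun i _ => ?_
  have hi : (i : ℕ) ≤ n := Nat.lt_succ_iff.1 i.2
  obtain ⟨k, hk⟩ := Nat.exists_eq_add_of_le hi
  have h1 : n + 1 - (i : ℕ) = k + 1 := by omega
  have h2 : (n + 1 - i : ℤ) = ((k + 1 : ℕ) : ℤ) := by omega
  have h3 : n + 1 = i + (k + 1) := by omega
  rw [h1, h2]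
  rcases lt_or_ge r (k + 1) with hr | hr
  · rw [φ.A_eq_zero hr, zero_mul, norm_zero]
    positivity
  refine (norm_mul_le _ _).trans ?_
  have h4 : S ^ Fintype.card F ^ (n + 1) =
      (S ^ Fintype.card F ^ (i : ℕ)) ^ Fintype.card F ^ (k + 1) := by
    rw [← pow_mul, ← pow_add, ← h3]
  rw [norm_twist, h4]
  gcongr
  · exact hB _
  · exact h i hi (by omega)

theorem tendsto_card_pow_pow {c : ℝ} (hc0 : 0 ≤ c) (hc : c < 1) :
    Tendsto (fun n : ℕ => c ^ Fintype.card F ^ n) atTop (𝓝 0) :=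
  (tendsto_pow_atTop_nhds_zero_of_lt_one hc0 hc).comp
    (tendsto_pow_atTop_atTop_of_one_lt Fintype.one_lt_card)

/-- This decay, faster than S^{q^n} for every S, makes exp_φ entire. The recursion gains a factor
q^{-q^n}, which absorbs B with room to spare, so a bound with base S improves to base S/(3/2) after
finitely many indices, and this can be iterated. -/
theorem eventually_norm_expCoeff_le {S : ℝ} (hS : 0 < S) :
    ∀ᶠ n in atTop, ‖φ.expCoeff n‖ ≤ S ^ Fintype.card F ^ n := by
  obtain ⟨B, hB1, hB⟩ := φ.exists_norm_A_le
  have hB0 : 0 < B := zero_lt_one.trans_le hB1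
  have hq : (2 : ℝ) ≤ Fintype.card F := by
    exact_mod_cast (Fintype.one_lt_card : 1 < Fintype.card F)
  have hq0 : (0 : ℝ) < Fintype.card F := by linarith
  -- Any constant strictly between 1 and 2 would serve in place of 3/2: being below q it absorbs B,
  -- and being above 1 it leaves a gain.
  have hlim : ∀ᶠ n in atTop, B * ((3 / 2) / Fintype.card F : ℝ) ^ Fintype.card F ^ n ≤ 1 := by
    have h := (tendsto_card_pow_pow (F := F) (c := (3 / 2) / Fintype.card F) (by positivity)
      (by rw [div_lt_one hq0]; linarith)).const_mul B
    rw [mul_zero] at h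
    exact h.eventually (ge_mem_nhds zero_lt_one)
  have hstep : ∀ S : ℝ, 0 < S → ∀ n, B * ((3 / 2) / Fintype.card F : ℝ) ^ Fintype.card F ^ n ≤ 1 →
      B * (S / Fintype.card F) ^ Fintype.card F ^ n ≤ (S / (3 / 2)) ^ Fintype.card F ^ n := by
    intro S hS n hn
    have h1 : S / Fintype.card F = (3 / 2) / Fintype.card F * (S / (3 / 2)) := by
      field_simp
    rw [h1, mul_pow, ← mul_assoc]
    exact mul_le_of_le_one_left (by positivity) hn
  obtain ⟨N, hN⟩ := eventually_atTop.1 hlim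
  -- A starting base valid for all n: S bounds the first N + 1 coefficients, and beyond N the
  -- recursion preserves the bound.
  have h0 : ∃ S : ℝ, 0 < S ∧ ∀ n, ‖φ.expCoeff n‖ ≤ S ^ Fintype.card F ^ n := by
    set S : ℝ := 1 + ∑ i ∈ Finset.range (N + 1), ‖φ.expCoeff i‖ with hSdef
    have hsum : 0 ≤ ∑ i ∈ Finset.range (N + 1), ‖φ.expCoeff i‖ :=
      Finset.sum_nonneg fun i _ => norm_nonneg _
    have hS1 : 1 ≤ S := by linarith
    refine ⟨S, by linarith, fun n => ?_⟩
    induction n using Nat.strong_induction_on with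
    | _ n ih =>
      rcases le_or_gt n N with hn | hn
      · have h1 := Finset.single_le_sum (fun i _ => norm_nonneg (φ.expCoeff i))
          (Finset.mem_range.2 (Nat.lt_succ_of_le hn))
        calc ‖φ.expCoeff n‖ ≤ S := by linarith
          _ ≤ _ := le_self_pow₀ hS1 (pow_ne_zero _ Fintype.card_ne_zero)
      · obtain ⟨m, rfl⟩ : ∃ m, n = m + 1 := ⟨n - 1, by omega⟩
        refine (φ.norm_expCoeff_succ_le hB0.le hB (by linarith) m
          fun i hi _ => ih i (by omega)).trans ?_
        refine (hstep S (by linarith) _ (hN _ hn.le)).trans ?_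
        gcongr
        exact div_le_self (by linarith) (by norm_num)
  obtain ⟨S₀, hS₀, hb⟩ := h0
  have hk : ∀ k : ℕ, ∀ᶠ n in atTop,
      ‖φ.expCoeff n‖ ≤ (S₀ / (3 / 2) ^ k) ^ Fintype.card F ^ n := by
    intro k
    induction k with
    | zero => exact Eventually.of_forall fun n => by simpa using hb n
    | succ k ih =>
      obtain ⟨M, hM⟩ := eventually_atTop.1 ih
      -- Waiting r further indices ensures that all r coefficients entering the recursion already
      -- obey the k-th bound.
      filter_upwards [eventually_ge_atTop (M + r + N + 1)] with n hn
      obtain ⟨m, rfl⟩ : ∃ m, n = m + 1 := ⟨n - 1, by omega⟩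
      refine (φ.norm_expCoeff_succ_le hB0.le hB (S := S₀ / (3 / 2) ^ k) (by positivity) m
        fun i _ hi => hM i (by omega)).trans ?_
      refine (hstep _ (by positivity) _ (hN _ (by omega))).trans_eq ?_
      rw [div_div, ← pow_succ]
  obtain ⟨k, hk'⟩ := pow_unbounded_of_one_lt (S₀ / S) (by norm_num : (1 : ℝ) < 3 / 2)
  filter_upwards [hk k] with n hn
  refine hn.trans ?_
  gcongr
  rw [div_le_iff₀ (by positivity)]
  rw [div_lt_iff₀ hS] at hk'
  linarith

theorem summable_norm_exp_bound {R : ℝ} (hR : 0 ≤ R) :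
    Summable fun i : ℕ => ‖φ.expCoeff i‖ * R ^ Fintype.card F ^ i := by
  have hR1 : 0 < R + 1 := by linarith
  have hg : Summable fun i : ℕ => (1 / 2 : ℝ) ^ i := summable_geometric_two
  refine Summable.of_norm_bounded_eventually_nat hg ?_
  -- The base is chosen so that multiplying by R + 1 leaves 1/2; using R + 1 instead of R avoids
  -- dividing by zero.
  filter_upwards [φ.eventually_norm_expCoeff_le (S := 1 / 2 / (R + 1)) (by positivity)] with i hi
  rw [Real.norm_of_nonneg (by positivity)]
  calc ‖φ.expCoeff i‖ * R ^ Fintype.card F ^ i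
      ≤ (1 / 2 / (R + 1)) ^ Fintype.card F ^ i * (R + 1) ^ Fintype.card F ^ i := by
        gcongr
        linarith
    _ = (1 / 2) ^ Fintype.card F ^ i := by
        rw [← mul_pow, div_mul_cancel₀ _ hR1.ne']
    _ ≤ (1 / 2) ^ i := pow_le_pow_of_le_one (by norm_num) (by norm_num)
        (Nat.lt_pow_self Fintype.one_lt_card).le

theorem norm_exp_term_le (f : Tate F s) (i : ℕ) :
    ‖φ.expCoeff i * twist (i : ℤ) f‖ ≤ ‖φ.expCoeff i‖ * ‖f‖ ^ Fintype.card F ^ i :=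
  (norm_mul_le _ _).trans_eq (by rw [norm_twist])

/-- The exponential series converges on all of `𝕋_s`. -/
theorem summable_exp (f : Tate F s) :
    Summable fun i : ℕ => φ.expCoeff i * twist (i : ℤ) f :=
  Summable.of_norm_bounded (φ.summable_norm_exp_bound (norm_nonneg f)) (φ.norm_exp_term_le f)

/-- This is the coefficient of τ^n in exp_φ θ = φ_θ exp_φ. The sum runs over a range independent of
n, with explicit zeros, so that it can be exchanged with the infinite sum over n. -/
theorem expCoeff_mul_twist_theta (n : ℕ) : φ.expCoeff n * twist (n : ℤ) (theta F s) =
    ∑ j ∈ Finset.range (r + 1),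
      if j ≤ n then φ.A j * twist (j : ℤ) (φ.expCoeff (n - j)) else 0 := by
  have h := congrArg (TwSeries.coeff n) ((φ.mul_theta_iff φ.expSeries
    (by rw [expSeries, TwSeries.coeff_mk, expCoeff])).2 rfl)
  rw [TwPoly.coeff_mul_const, TwSeries.coeff_mul,
    Finset.Nat.sum_antidiagonal_eq_sum_range_succ_mk] at h
  rw [twist_natCast]
  refine h.trans ?_
  rw [← Finset.sum_filter]
  symm
  refine Finset.sum_subset_zero_on_sdiff (fun j hj => ?_) (fun j hj => ?_) fun j hj => ?_
  · simp only [Finset.mem_filter, Finset.mem_range] at hj ⊢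
    omega
  · simp only [Finset.mem_sdiff, Finset.mem_filter, Finset.mem_range] at hj
    have h0 : φ.phiTheta.1.coeff j = 0 := φ.A_eq_zero (by omega)
    rw [h0, zero_mul]
  · rw [twist_natCast]
    rfl

/-- The functional equation `exp_φ(θ f) = φ_θ(exp_φ f)`. -/
theorem exp_theta_mul (f : Tate F s) : φ.exp (theta F s * f) = φ.phiAct (φ.exp f) := by
  -- Apply A_j τ^j to the series of exp_φ(f) and index the result by the total τ-degree n = i + j;
  -- the terms with n < j are zero.
  have h1 : ∀ j : ℕ, HasSum (fun n : ℕ => if j ≤ n then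
      φ.A j * twist (j : ℤ) (φ.expCoeff (n - j) * twist ((n - j : ℕ) : ℤ) f) else 0)
      (φ.A j * twist (j : ℤ) (φ.exp f)) := by
    intro j
    have h2 := ((φ.summable_exp f).hasSum.map
      ((twist (j : ℤ) : Tate F s ≃+* Tate F s) : Tate F s →+* Tate F s)
      (continuous_twist j)).mul_left (φ.A j)
    rw [← Function.Injective.hasSum_iff (g := fun i : ℕ => i + j) (add_left_injective j)]
    · refine h2.congr_fun fun i => ?_
      simp
    · intro n hn
      rw [if_neg]
      intro hjn
      exact hn ⟨n - j, by dsimp only; omega⟩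
  have h3 := hasSum_sum fun j (_ : j ∈ Finset.range (r + 1)) => h1 j
  rw [phiAct_apply, ← h3.tsum_eq, exp]
  refine tsum_congr fun n => ?_
  rw [map_mul, ← mul_assoc, expCoeff_mul_twist_theta, Finset.sum_mul]
  refine Finset.sum_congr rfl fun j _ => ?_
  split_ifs with hj
  · rw [map_mul, ← twist_add, mul_assoc]
    congr 4
    omega
  · rw [zero_mul]

/-- The terms of degree i ≥ 1 at θ^{-n} f carry a factor of norm at most q^{-n q^i} ≤ q^{-2n}, so
after multiplication by θ^n the error is still O(q^{-n}). -/
theorem exp_approx (f : Tate F s) :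
    Tendsto (fun n : ℕ => theta F s ^ n * φ.exp (thetaInv F s ^ n * f)) atTop (𝓝 f) := by
  have hq : (2 : ℝ) ≤ Fintype.card F := by
    exact_mod_cast (Fintype.one_lt_card : 1 < Fintype.card F)
  have hq0 : (0 : ℝ) < Fintype.card F := by linarith
  set q : ℝ := (Fintype.card F : ℝ) with hqdef
  have hs := φ.summable_norm_exp_bound (norm_nonneg f)
  have hs1 := (summable_nat_add_iff 1).2 hs
  set K : ℝ := ∑' i : ℕ, ‖φ.expCoeff (i + 1)‖ * ‖f‖ ^ Fintype.card F ^ (i + 1) with hK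
  rw [tendsto_iff_norm_sub_tendsto_zero]
  have hlim : Tendsto (fun n : ℕ => q⁻¹ ^ n * K) atTop (𝓝 0) := by
    have := (tendsto_pow_atTop_nhds_zero_of_lt_one (r := q⁻¹) (by positivity)
      (inv_lt_one_of_one_lt₀ (by linarith))).mul_const K
    rwa [zero_mul] at this
  refine squeeze_zero (fun _ => norm_nonneg _) (fun n => ?_) hlim
  have h1 : φ.exp (thetaInv F s ^ n * f) = thetaInv F s ^ n * f +
      ∑' i : ℕ, φ.expCoeff (i + 1) * twist ((i + 1 : ℕ) : ℤ) (thetaInv F s ^ n * f) := by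
    rw [exp, (φ.summable_exp _).tsum_eq_zero_add]
    congr 1
    rw [expCoeff, one_mul, Nat.cast_zero, twist_zero]
  have h2 : theta F s ^ n * φ.exp (thetaInv F s ^ n * f) - f = theta F s ^ n *
      ∑' i : ℕ, φ.expCoeff (i + 1) * twist ((i + 1 : ℕ) : ℤ) (thetaInv F s ^ n * f) := by
    rw [h1, mul_add, ← mul_assoc, ← mul_pow, theta_mul_thetaInv, one_pow, one_mul,
      add_sub_cancel_left]
  have h3 : ‖thetaInv F s ^ n * f‖ ≤ q⁻¹ ^ n * ‖f‖ :=
    (norm_mul_le _ _).trans (by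
      gcongr
      exact (norm_pow_le _ n).trans_eq (by rw [norm_thetaInv]))
  have h4 : ‖∑' i : ℕ, φ.expCoeff (i + 1) * twist ((i + 1 : ℕ) : ℤ) (thetaInv F s ^ n * f)‖ ≤
      (q⁻¹ ^ n) ^ 2 * K := by
    refine tsum_of_norm_bounded (hs1.hasSum.mul_left _) fun i => ?_
    refine (φ.norm_exp_term_le _ _).trans ?_
    have h5 : 2 ≤ Fintype.card F ^ (i + 1) :=
      Nat.one_lt_pow i.succ_ne_zero Fintype.one_lt_card
    have h6 : q⁻¹ ^ n ≤ 1 := pow_le_one₀ (by positivity) (inv_le_one_of_one_le₀ (by linarith))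
    calc _ ≤ ‖φ.expCoeff (i + 1)‖ * (q⁻¹ ^ n * ‖f‖) ^ Fintype.card F ^ (i + 1) := by gcongr
      _ = (q⁻¹ ^ n) ^ Fintype.card F ^ (i + 1) *
          (‖φ.expCoeff (i + 1)‖ * ‖f‖ ^ Fintype.card F ^ (i + 1)) := by rw [mul_pow]; ring
      _ ≤ _ := by
        gcongr ?_ * _
        exact pow_le_pow_of_le_one (by positivity) h6 h5
  rw [h2]
  calc _ ≤ ‖theta F s ^ n‖ * _ := norm_mul_le _ _
    _ ≤ q ^ n * ((q⁻¹ ^ n) ^ 2 * K) := by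
        gcongr
        exact (norm_pow_le _ n).trans_eq (by rw [norm_theta])
    _ = q⁻¹ ^ n * K := by
        have h7 : q ^ n * q⁻¹ ^ n = 1 := by rw [← mul_pow, mul_inv_cancel₀ hq0.ne', one_pow]
        linear_combination (q⁻¹ ^ n * K) * h7

/-- A sequence with `φ_θ(e_{n+1}) = e_n` and `θ^n e_n → 0` vanishes. -/
theorem eq_zero_of_phiAct_tower (e : ℕ → Tate F s) (he : ∀ n, φ.phiAct (e (n + 1)) = e n)
    (hlim : Tendsto (fun n => theta F s ^ n * e n) atTop (𝓝 0)) (n : ℕ) : e n = 0 := by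
  have hq : (1 : ℝ) < Fintype.card F := by exact_mod_cast Fintype.one_lt_card
  have hnorm : ∀ n, ‖theta F s ^ n * e n‖ = (Fintype.card F : ℝ) ^ n * ‖e n‖ := fun n => by
    rw [theta, ← map_pow, Tate.norm_const_mul, norm_pow, norm_toCInf, inftyAbs_X]
  have hlim' : Tendsto (fun n => (Fintype.card F : ℝ) ^ n * ‖e n‖) atTop (𝓝 0) := by
    simpa only [hnorm, norm_zero] using hlim.norm
  obtain ⟨ε, hε, hφ⟩ := φ.exists_norm_phiAct_le
  obtain ⟨N, hN⟩ := eventually_atTop.1 (hlim'.eventually (ge_mem_nhds hε))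
  -- Once e_{n+1} lies in the ball of radius ε, the bound ‖φ_θ(e_{n+1})‖ ≤ q ‖e_{n+1}‖ makes q^n
  -- ‖e_n‖ nondecreasing. A nondecreasing nonnegative sequence tending to 0 is zero.
  have hmono : ∀ n ≥ N, (Fintype.card F : ℝ) ^ n * ‖e n‖ ≤
      (Fintype.card F : ℝ) ^ (n + 1) * ‖e (n + 1)‖ := by
    intro n hn
    have h1 : ‖e (n + 1)‖ ≤ ε :=
      (le_mul_of_one_le_left (norm_nonneg _) (one_le_pow₀ hq.le)).trans (hN (n + 1) (by omega))
    have h2 := hφ _ h1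
    rw [he] at h2
    rw [pow_succ, mul_assoc]
    gcongr
  have hzero : ∀ n ≥ N, e n = 0 := by
    intro n hn
    have h1 : ∀ m ≥ n, (Fintype.card F : ℝ) ^ n * ‖e n‖ ≤ (Fintype.card F : ℝ) ^ m * ‖e m‖ := by
      intro m hm
      induction m, hm using Nat.le_induction with
      | base => exact le_rfl
      | succ m hm ih => exact ih.trans (hmono m (by omega))
    have h2 := ge_of_tendsto hlim' (eventually_atTop.2 ⟨n, h1⟩)
    have h3 := nonpos_of_mul_nonpos_right h2 (by positivity)
    simpa using h3
  have hback : ∀ k n, N ≤ n + k → e n = 0 := by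
    intro k
    induction k with
    | zero => exact fun n hn => hzero n hn
    | succ k ih =>
      intro n hn
      rw [← he, ih (n + 1) (by omega), map_zero]
  exact hback N n (by omega)

end DrinfeldModule

/-! ## Twisted polynomials -/

namespace TwPoly
variable {R : Type*} [CommRing R] {σ : RingAut R}

theorem gen_pow_mul_const (i : ℕ) (b : R) :
    gen σ ^ i * const σ b = const σ ((σ ^ i) b) * gen σ ^ i := by
  refine ext fun n => ?_
  have h1 : (gen σ ^ i * const σ b).coeff n = (gen σ ^ i).coeff n * (σ ^ n) b :=
    coeff_mul_const b (gen σ ^ i).1 n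
  have h2 : (const σ ((σ ^ i) b) * gen σ ^ i).coeff n = (σ ^ i) b * (gen σ ^ i).coeff n :=
    coeff_const_mul _ (gen σ ^ i).1 n
  rw [h1, h2, coeff_gen_pow]
  split_ifs with h
  · rw [h, one_mul, mul_one]
  · rw [zero_mul, mul_zero]

theorem smul_gen_pow_mul (a b : R) (i k : ℕ) :
    (a • gen σ ^ i) * (b • gen σ ^ k) = (a * (σ ^ i) b) • gen σ ^ (i + k) := by
  rw [smul_def, smul_def, smul_def, mul_assoc, ← mul_assoc (gen σ ^ i), gen_pow_mul_const, map_mul,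
    pow_add]
  simp only [mul_assoc]

theorem gen_mul_smul (a : R) (m : TwPoly σ) : gen σ * (a • m) = σ a • (gen σ * m) := by
  have h := gen_pow_mul_const (σ := σ) 1 a
  rw [pow_one, pow_one] at h
  rw [smul_def, smul_def, ← mul_assoc, h, mul_assoc]

theorem eq_sum (m : TwPoly σ) {N : ℕ} (hN : ∀ n, N ≤ n → m.coeff n = 0) :
    m = ∑ i ∈ Finset.range N, m.coeff i • gen σ ^ i := by
  refine ext fun n => ?_
  rw [coeff_sum]
  simp only [coeff_smul, coeff_gen_pow, mul_ite, mul_one, mul_zero, Finset.sum_ite_eq,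
    Finset.mem_range]
  split_ifs with h
  · rfl
  · exact hN n (not_lt.1 h)

theorem coeff_zero_mul (f g : TwPoly σ) : (f * g).coeff 0 = f.coeff 0 * g.coeff 0 := by
  change (f.1 * g.1).coeff 0 = _
  rw [TwSeries.coeff_mul]
  simp only [Finset.HasAntidiagonal.antidiagonal_zero, Finset.sum_singleton, pow_zero]
  rfl

theorem coeff_add (f g : TwPoly σ) (n : ℕ) : (f + g).coeff n = f.coeff n + g.coeff n := rfl

end TwPoly

/-! ### The map δ_1 and its compatibility with σ and φ_θ -/

theorem delta1_eq_sum (m : SigmaPoly F s) {N : ℕ} (hN : ∀ n, N ≤ n → m.coeff n = 0) :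
    delta1 m = ∑ i ∈ Finset.range N, twist (i : ℤ) (m.coeff i) := by
  refine finsum_eq_sum_of_support_subset _ fun i hi => ?_
  rw [Finset.coe_range, Set.mem_Iio]
  by_contra h
  exact hi (by dsimp only; rw [hN i (not_lt.1 h), map_zero])

theorem delta1_add (m n : SigmaPoly F s) : delta1 (m + n) = delta1 m + delta1 n := by
  obtain ⟨M, hM⟩ := m.2
  obtain ⟨N, hN⟩ := n.2
  have hM' : ∀ k, max M N ≤ k → m.coeff k = 0 := fun k hk => hM k (le_of_max_le_left hk)
  have hN' : ∀ k, max M N ≤ k → n.coeff k = 0 := fun k hk => hN k (le_of_max_le_right hk)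
  rw [delta1_eq_sum m hM', delta1_eq_sum n hN', delta1_eq_sum (m + n) (N := max M N)
    fun k hk => by rw [TwPoly.coeff_add, hM' k hk, hN' k hk, add_zero], ← Finset.sum_add_distrib]
  exact Finset.sum_congr rfl fun i _ => by rw [TwPoly.coeff_add, map_add]

/-- `δ_1` as an additive homomorphism. -/
def delta1Hom : SigmaPoly F s →+ Tate F s := AddMonoidHom.mk' delta1 delta1_add

theorem delta1_smul_gen_pow (c : Tate F s) (n : ℕ) :
    delta1 (c • TwPoly.gen _ ^ n : SigmaPoly F s) = twist (n : ℤ) c := by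
  rw [delta1_eq_sum (N := n + 1) _ fun k hk => by
    rw [TwPoly.coeff_smul, TwPoly.coeff_gen_pow, if_neg (by omega), mul_zero]]
  rw [Finset.sum_eq_single_of_mem n (by simp)]
  · rw [TwPoly.coeff_smul, TwPoly.coeff_gen_pow, if_pos rfl, mul_one]
  · intro i _ hi
    rw [TwPoly.coeff_smul, TwPoly.coeff_gen_pow, if_neg hi, mul_zero, map_zero]

theorem tau_inv_pow (n : ℕ) (f : Tate F s) : ((tau F s)⁻¹ ^ n) f = twist (-(n : ℤ)) f := by
  rw [twist, zpow_neg, zpow_natCast, inv_pow]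

/-- On monomials, σ · a σ^i = a^{(-1)} σ^{i+1}, and the extra twist by i + 1 undoes the -1. So δ_1
kills (σ - 1) 𝕋_s[σ]. -/
theorem delta1_gen_mul (m : SigmaPoly F s) : delta1 (TwPoly.gen _ * m) = delta1 m := by
  obtain ⟨N, hN⟩ := m.2
  change delta1Hom _ = delta1Hom m
  rw [TwPoly.eq_sum m hN, Finset.mul_sum, map_sum, map_sum]
  refine Finset.sum_congr rfl fun i _ => ?_
  rw [TwPoly.gen_mul_smul, ← pow_succ']
  refine (delta1_smul_gen_pow _ _).trans (Eq.trans ?_ (delta1_smul_gen_pow _ _).symm)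
  have h := tau_inv_pow 1 (m.coeff i)
  rw [pow_one] at h
  rw [h, ← twist_add]
  congr 1
  push_cast
  ring_nf

namespace DrinfeldModule
variable {r : ℕ} (φ : DrinfeldModule F s r)

theorem starMap_phiTheta : starMap φ.phiTheta = ∑ k ∈ Finset.range (r + 1),
    twist (-(k : ℤ)) (φ.A k) • (TwPoly.gen _ ^ k : SigmaPoly F s) :=
  TwPoly.eq_sum (starMap φ.phiTheta) fun n hn => by
    change twist (-(n : ℤ)) (φ.A n) = 0
    rw [φ.A_eq_zero hn, map_zero]

theorem coeff_zero_starMap : (starMap φ.phiTheta).coeff 0 = theta F s := by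
  change twist (-((0 : ℕ) : ℤ)) (φ.A 0) = _
  rw [Nat.cast_zero, neg_zero, twist_zero, A_zero]

/-- `δ_1` intertwines right multiplication by `φ_θ^*` with `φ_θ`. -/
theorem delta1_mul_starMap (m : SigmaPoly F s) :
    delta1 (m * starMap φ.phiTheta) = φ.phiAct (delta1 m) := by
  obtain ⟨N, hN⟩ := m.2
  change delta1Hom _ = φ.phiAct (delta1Hom m)
  rw [TwPoly.eq_sum m hN, starMap_phiTheta, Finset.sum_mul, map_sum, map_sum, map_sum]
  refine Finset.sum_congr rfl fun i _ => ?_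
  rw [Finset.mul_sum, map_sum, phiAct_apply]
  refine Finset.sum_congr rfl fun k _ => ?_
  -- On monomials, a σ^i · A_k^{(-k)} σ^k = a A_k^{(-k-i)} σ^{i+k}, which δ_1 sends to A_k
  -- (a^{(i)})^{(k)}.
  rw [TwPoly.smul_gen_pow_mul, tau_inv_pow]
  refine (delta1_smul_gen_pow _ _).trans ?_
  change _ = φ.A k * twist (k : ℤ) (delta1 (m.coeff i • TwPoly.gen _ ^ i : SigmaPoly F s))
  rw [delta1_smul_gen_pow, map_mul, ← twist_add, ← twist_add, ← twist_add, mul_comm]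
  congr 1
  · rw [show ((i + k : ℕ) : ℤ) + -(i : ℤ) + -(k : ℤ) = 0 by push_cast; ring, twist_zero]
  · rw [show ((i + k : ℕ) : ℤ) = k + i by push_cast; ring]

/-! ## The `𝕋_s[z]`-action -/

theorem zAct_add (p q : (Tate F s)[X]) (m : SigmaPoly F s) :
    φ.zAct (p + q) m = φ.zAct p m + φ.zAct q m := by
  simp [zAct]

theorem zAct_mul (p q : (Tate F s)[X]) (m : SigmaPoly F s) :
    φ.zAct (p * q) m = φ.zAct p (φ.zAct q m) := by
  simp [zAct]

theorem zAct_C (c : Tate F s) (m : SigmaPoly F s) : φ.zAct (Polynomial.C c) m = c • m := by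
  simp [zAct]

theorem zAct_X (m : SigmaPoly F s) : φ.zAct Polynomial.X m = m * starMap φ.phiTheta := by
  simp [zAct, TwPoly.rightMul]

theorem zAct_sum {κ : Type*} (t : Finset κ) (p : κ → (Tate F s)[X]) (m : SigmaPoly F s) :
    φ.zAct (∑ i ∈ t, p i) m = ∑ i ∈ t, φ.zAct (p i) m := by
  simp [zAct, LinearMap.sum_apply]

theorem zAct_sum_right {κ : Type*} (p : (Tate F s)[X]) (t : Finset κ) (m : κ → SigmaPoly F s) :
    φ.zAct p (∑ i ∈ t, m i) = ∑ i ∈ t, φ.zAct p (m i) :=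
  map_sum (Polynomial.aeval (TwPoly.rightMul (starMap φ.phiTheta)) p) _ _

/-- The coefficientwise twist by `σ` on `𝕋_s[z]`. -/
def sigmaPoly (p : (Tate F s)[X]) : (Tate F s)[X] :=
  p.map ((twist (-1) : Tate F s ≃+* Tate F s) : Tate F s →+* Tate F s)

theorem sigmaPoly_C (c : Tate F s) :
    sigmaPoly (Polynomial.C c) = Polynomial.C (twist (-1) c) := by
  simp [sigmaPoly]

/-- The variable z acts on the right, hence commutes with left multiplication by σ; only the
coefficients get twisted. -/
theorem zAct_sigmaPoly_gen_mul (p : (Tate F s)[X]) (m : SigmaPoly F s) :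
    φ.zAct (sigmaPoly p) (TwPoly.gen _ * m) = TwPoly.gen _ * φ.zAct p m := by
  have hC : ∀ (c : Tate F s) (m : SigmaPoly F s),
      φ.zAct (sigmaPoly (Polynomial.C c)) (TwPoly.gen _ * m) =
        TwPoly.gen _ * φ.zAct (Polynomial.C c) m := by
    intro c m
    rw [sigmaPoly_C, zAct_C, zAct_C, TwPoly.gen_mul_smul]
    congr 1
  induction p using Polynomial.induction_on generalizing m with
  | C c => exact hC c m
  | add p q hp hq =>
    rw [sigmaPoly, Polynomial.map_add, zAct_add, zAct_add, mul_add]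
    congr 1
    · exact hp m
    · exact hq m
  | monomial n c ih =>
    rw [pow_succ, ← mul_assoc, sigmaPoly, Polynomial.map_mul, Polynomial.map_X, zAct_mul, zAct_mul,
      zAct_X, zAct_X, mul_assoc]
    exact ih _

/-- Taking the constant term is multiplicative on 𝕋_s[σ] and sends φ_θ^* to θ, so z acts there as θ.
-/
theorem coeff_zero_zAct (p : (Tate F s)[X]) (m : SigmaPoly F s) :
    (φ.zAct p m).coeff 0 = p.eval (theta F s) * m.coeff 0 := by
  induction p using Polynomial.induction_on generalizing m with
  | C c => rw [zAct_C, TwPoly.coeff_smul, Polynomial.eval_C]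
  | add p q hp hq => rw [zAct_add, TwPoly.coeff_add, hp, hq, Polynomial.eval_add, add_mul]
  | monomial n c ih =>
    rw [pow_succ, ← mul_assoc, zAct_mul, zAct_X, ih, TwPoly.coeff_zero_mul, coeff_zero_starMap,
      Polynomial.eval_mul_X]
    ring

theorem iota_add (h k : Fin r → (Tate F s)[X]) : φ.iota (h + k) = φ.iota h + φ.iota k := by
  simp only [iota, Pi.add_apply, zAct_add, Finset.sum_add_distrib]

theorem iota_X_mul (h : Fin r → (Tate F s)[X]) :
    φ.iota (fun j => Polynomial.X * h j) = φ.iota h * starMap φ.phiTheta := by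
  simp only [iota, zAct_mul, zAct_X, Finset.sum_mul]

/-- `ι(P^{(-1)} Φ) = σ ι(P)`. -/
theorem iota_sigmaPoly_mul_Phi (hA : IsUnit (φ.A r)) (P : Fin r → (Tate F s)[X]) :
    φ.iota (fun j => ∑ i, sigmaPoly (P i) * φ.Phi i j) = TwPoly.gen _ * φ.iota P := by
  simp only [iota, zAct_sum, zAct_mul, Finset.mul_sum]
  rw [Finset.sum_comm]
  refine Finset.sum_congr rfl fun i _ => ?_
  rw [← zAct_sum_right, ← φ.Phi_spec hA, zAct_sigmaPoly_gen_mul]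

theorem delta0_iota (h : Fin r → (Tate F s)[X]) :
    delta0 (φ.iota h) = (h ⟨0, φ.rank_pos⟩).eval (theta F s) := by
  rw [delta0, iota, TwPoly.coeff_sum, Finset.sum_eq_single ⟨0, φ.rank_pos⟩]
  · rw [coeff_zero_zAct, TwPoly.coeff_gen_pow, if_pos rfl, mul_one]
  · intro i _ hi
    rw [coeff_zero_zAct, TwPoly.coeff_gen_pow, if_neg, mul_zero]
    exact fun h0 => hi (Fin.ext h0.symm)
  · simp

theorem delta1_iota_const (h : Fin r → (Tate F s)[X]) (c : Tate F s)
    (h0 : h ⟨0, φ.rank_pos⟩ = Polynomial.C c) (h1 : ∀ i : Fin r, (i : ℕ) ≠ 0 → h i = 0) :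
    delta1 (φ.iota h) = c := by
  have h2 : φ.iota h = c • (TwPoly.gen _ ^ 0 : SigmaPoly F s) := by
    rw [iota, Finset.sum_eq_single ⟨0, φ.rank_pos⟩]
    · rw [h0, zAct_C]
    · intro i _ hi
      rw [h1 i fun hi0 => hi (Fin.ext hi0)]
      simp [zAct]
    · simp
  rw [h2, delta1_smul_gen_pow, Nat.cast_zero, twist_zero]

/-- The only nonzero entry of the first column is the bottom one, a multiple of z - θ. This removes
the twisted term when the first entry is evaluated at θ. -/
theorem eval_theta_Phi_zero (i : Fin r) :
    (φ.Phi i ⟨0, φ.rank_pos⟩).eval (theta F s) = 0 := by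
  simp only [Phi, Matrix.of_apply]
  split_ifs <;> simp_all

theorem Phi_eq (i j : Fin r) : φ.Phi i j = Polynomial.C ((φ.Phi i j).coeff 0) +
    Polynomial.C ((φ.Phi i j).coeff 1) * Polynomial.X := by
  have h : (φ.Phi i j).natDegree ≤ 1 := by
    simp only [Phi, Matrix.of_apply]
    split_ifs
    · refine (Polynomial.natDegree_C_mul_le _ _).trans (Polynomial.natDegree_X_sub_C_le _)
    · refine (Polynomial.natDegree_C_mul_le _ _).trans ?_
      rw [Polynomial.natDegree_neg, Polynomial.natDegree_C]
      exact zero_le_one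
    · simp
    · simp
  rw [add_comm]
  exact Polynomial.eq_X_add_C_of_natDegree_le_one h

/-- Since z occurs only in the first column, the correction term in `divided` affects only the first
entry. -/
theorem coeff_one_Phi {i j : Fin r} (hj : (j : ℕ) ≠ 0) : (φ.Phi i j).coeff 1 = 0 := by
  simp only [Phi, Matrix.of_apply, hj, if_false]
  split_ifs <;> simp [Polynomial.coeff_one, ← Polynomial.C_neg, ← Polynomial.C_mul,
    -map_neg, -map_mul]

end DrinfeldModule

/-! ## Evaluation at `z = θ` and the map `D_0` -/

theorem norm_coeff_mul_theta_pow_le (f : tateDisk F s) (i : ℕ) :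
    ‖PowerSeries.coeff i f.1 * theta F s ^ i‖ ≤
      ‖theta F s‖ ^ i * ‖PowerSeries.coeff i f.1‖ := by
  rw [mul_comm]
  exact (norm_mul_le _ _).trans (by gcongr; exact norm_pow_le _ i)

/-- In a complete ultrametric group, terms tending to zero suffice. -/
theorem summable_evalDisk (f : tateDisk F s) :
    Summable fun i => PowerSeries.coeff i f.1 * theta F s ^ i := by
  refine NonarchimedeanAddGroup.summable_of_tendsto_cofinite_zero ?_
  rw [Nat.cofinite_eq_atTop]
  exact squeeze_zero_norm (norm_coeff_mul_theta_pow_le f) f.2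

/-- The evaluation `∑ a_i z^i ↦ ∑ a_i θ^i` on `𝕋_s{z/θ}`. -/
def evalDisk : tateDisk F s →+ Tate F s :=
  AddMonoidHom.mk' (fun f => ∑' i, PowerSeries.coeff i f.1 * theta F s ^ i) fun f g => by
    rw [← (summable_evalDisk f).tsum_add (summable_evalDisk g)]
    refine tsum_congr fun i => ?_
    change PowerSeries.coeff i (f.1 + g.1) * _ = _
    rw [map_add, add_mul]

theorem hasSum_evalDisk (f : tateDisk F s) :
    HasSum (fun i => PowerSeries.coeff i f.1 * theta F s ^ i) (evalDisk f) :=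
  (summable_evalDisk f).hasSum

theorem norm_evalDisk_le (f : tateDisk F s) : ‖evalDisk f‖ ≤ ‖f‖ := by
  refine le_of_tendsto (hasSum_evalDisk f).norm (Eventually.of_forall fun t => ?_)
  exact IsUltrametricDist.norm_sum_le_of_forall_le_of_nonneg (norm_nonneg f) fun i _ =>
    (norm_coeff_mul_theta_pow_le f i).trans (le_ciSup (tateDisk_bddAbove f) i)

theorem continuous_evalDisk : Continuous (evalDisk : tateDisk F s → Tate F s) :=
  AddMonoidHomClass.continuous_of_bound evalDisk 1 fun f => by
    rw [one_mul]
    exact norm_evalDisk_le f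

theorem evalDisk_polyToDisk (p : (Tate F s)[X]) :
    evalDisk (polyToDisk p) = p.eval (theta F s) := by
  rw [Polynomial.eval_eq_sum_range]
  refine (hasSum_evalDisk _).unique ?_
  have h : ∀ i, PowerSeries.coeff i (polyToDisk p).1 = p.coeff i := Polynomial.coeff_coe p
  simp only [h]
  refine hasSum_sum_of_ne_finset_zero fun i hi => ?_
  rw [Polynomial.coeff_eq_zero_of_natDegree_lt (by simpa using hi), zero_mul]

namespace DrinfeldModule
variable {r : ℕ} (φ : DrinfeldModule F s r)

/-- `δ_0 ∘ ι` extends continuously, to the evaluation of the first entry at `θ`. -/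
theorem tendsto_delta0_iota (G : Fin r → tateDisk F s) :
    Tendsto (fun k => delta0 (φ.iota k)) (comap vecToDisk (𝓝 G))
      (𝓝 (evalDisk (G ⟨0, φ.rank_pos⟩))) := by
  have h : Continuous fun G : Fin r → tateDisk F s => evalDisk (G ⟨0, φ.rank_pos⟩) :=
    continuous_evalDisk.comp (continuous_apply _)
  refine ((h.tendsto G).comp tendsto_comap).congr fun k => ?_
  rw [delta0_iota, ← evalDisk_polyToDisk]
  rfl

/-- Density of the polynomial vectors makes the comap filter nontrivial, so the limit is unique and
equals the evaluation. -/
theorem D0_eq (G : Fin r → tateDisk F s) : φ.D0 G = evalDisk (G ⟨0, φ.rank_pos⟩) := by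
  have : (comap (vecToDisk : (Fin r → (Tate F s)[X]) → Fin r → tateDisk F s) (𝓝 G)).NeBot :=
    comap_neBot_iff.2 fun _ ht => denseRange_vecToDisk.mem_nhds ht
  exact (φ.tendsto_delta0_iota G).limUnder_eq

/-! ## Successive division by `z` -/

section Division
variable (h : Fin r → (Tate F s)[X]) (g : Fin r → PowerSeries (Tate F s))

/-- The coefficient of `z^{n-1}` of `g_i`, read as `0` for `n = 0`. -/
def prevCoeff (i : Fin r) : ℕ → Tate F s
  | 0 => 0
  | n + 1 => PowerSeries.coeff n (g i)

/-- If `g = ∑ g_k z^k` solves `g^{(-1)} Φ - g = h`, this is the polynomial vector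
`(g')^{(-1)} Φ - g'` with `g' = ∑_{k ≥ n} g_k z^{k-n}`. -/
def divided (n : ℕ) (j : Fin r) : (Tate F s)[X] :=
  -- Dropping the terms of g below z^n changes the coefficients of degree at least n only through
  -- the product of g_{n-1}^{(-1)} with the z-coefficient of Φ, which lands in degree n and so
  -- becomes a constant after division by z^n.
  Polynomial.divX^[n] (h j) -
    Polynomial.C (∑ i, twist (-1) (prevCoeff g i n) * (φ.Phi i j).coeff 1)

theorem coeff_divX_iterate (p : (Tate F s)[X]) (n k : ℕ) :
    (Polynomial.divX^[n] p).coeff k = p.coeff (n + k) := by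
  induction n generalizing k with
  | zero => simp
  | succ n ih =>
    rw [Function.iterate_succ_apply', Polynomial.coeff_divX, ih]
    congr 1
    omega

theorem divided_zero : φ.divided h g 0 = h := by
  ext1 j
  simp [divided, prevCoeff]

/-- The equation `g^{(-1)} Φ - g = h`. -/
def IsSolution : Prop :=
  Matrix.vecMul
      (fun j => PowerSeries.map
        ((twist (-1) : Tate F s ≃+* Tate F s) : Tate F s →+* Tate F s) (g j))
      (φ.Phi.map fun p => (p : PowerSeries (Tate F s))) - g =
    fun j => (h j : PowerSeries (Tate F s))

variable {φ h g}

theorem IsSolution.coeff_equation (hg : φ.IsSolution h g) (n : ℕ) (j : Fin r) :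
    ∑ i, twist (-1) (PowerSeries.coeff n (g i)) * (φ.Phi i j).coeff 0 +
      ∑ i, twist (-1) (prevCoeff g i n) * (φ.Phi i j).coeff 1 - PowerSeries.coeff n (g j) =
      (h j).coeff n := by
  have h1 := congrArg (PowerSeries.coeff n) (congrFun hg j)
  rw [Polynomial.coeff_coe] at h1
  rw [← h1, Pi.sub_apply, map_sub, Matrix.vecMul, dotProduct, map_sum, ← Finset.sum_add_distrib]
  congr 1
  refine Finset.sum_congr rfl fun i _ => ?_
  rw [Matrix.map_apply]
  conv_rhs => rw [φ.Phi_eq i j]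
  rw [Polynomial.coe_add, Polynomial.coe_mul, Polynomial.coe_C, Polynomial.coe_C, Polynomial.coe_X,
    mul_add, map_add, PowerSeries.coeff_mul_C, PowerSeries.coeff_map, ← mul_assoc]
  congr 1
  cases n with
  | zero => simp [prevCoeff]
  | succ n =>
    rw [PowerSeries.coeff_succ_mul_X, PowerSeries.coeff_mul_C, PowerSeries.coeff_map]
    rfl

/-- The operator P ↦ P^{(-1)} Φ - P applied to "tail from n equals g_n plus z times tail from n +
1". -/
theorem IsSolution.X_mul_divided_succ (hg : φ.IsSolution h g) (n : ℕ) (j : Fin r) :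
    Polynomial.X * φ.divided h g (n + 1) j +
      ∑ i, sigmaPoly (Polynomial.C (PowerSeries.coeff n (g i))) * φ.Phi i j =
    φ.divided h g n j + Polynomial.C (PowerSeries.coeff n (g j)) := by
  have hsum : ∑ i, sigmaPoly (Polynomial.C (PowerSeries.coeff n (g i))) * φ.Phi i j =
      Polynomial.C (∑ i, twist (-1) (PowerSeries.coeff n (g i)) * (φ.Phi i j).coeff 0) +
      Polynomial.C (∑ i, twist (-1) (PowerSeries.coeff n (g i)) * (φ.Phi i j).coeff 1) *
        Polynomial.X := by
    rw [map_sum, map_sum, Finset.sum_mul, ← Finset.sum_add_distrib]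
    refine Finset.sum_congr rfl fun i _ => ?_
    conv_lhs => rw [φ.Phi_eq i j]
    rw [sigmaPoly_C, map_mul, map_mul]
    ring
  have heq := hg.coeff_equation n j
  rw [hsum]
  ext k
  -- Degree 0 is the coefficient equation at n, degree 1 cancels the correction in `divided` at n +
  -- 1, and higher degrees are a shift of h.
  rcases k with _ | _ | k
  · simp only [divided, Polynomial.coeff_add, Polynomial.coeff_sub, Polynomial.mul_coeff_zero,
      Polynomial.coeff_X_zero, Polynomial.coeff_C_zero, coeff_divX_iterate, add_zero, zero_mul,
      mul_zero, zero_add, ← heq]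
    ring
  · simp only [divided, Polynomial.coeff_add, Polynomial.coeff_sub, Polynomial.coeff_X_mul,
      Polynomial.coeff_mul_X, Polynomial.coeff_C_zero, coeff_divX_iterate, Polynomial.coeff_C_succ,
      zero_add, add_zero, sub_zero, prevCoeff]
    ring
  · simp only [divided, Polynomial.coeff_add, Polynomial.coeff_sub, Polynomial.coeff_X_mul,
      Polynomial.coeff_mul_X, coeff_divX_iterate, Polynomial.coeff_C_succ,
      add_zero, sub_zero]
    congr 1
    omega

/-- After δ_1 ∘ ι the division identity has δ_1(ι(g_n)) on both sides, because δ_1 ignores left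
multiplication by σ; cancelling it leaves the tower relation. -/
theorem IsSolution.delta1_iota_divided (hg : φ.IsSolution h g) (hA : IsUnit (φ.A r)) (n : ℕ) :
    φ.phiAct (delta1 (φ.iota (φ.divided h g (n + 1)))) = delta1 (φ.iota (φ.divided h g n)) := by
  have h1 := congrArg (fun v => delta1 (φ.iota v))
    (funext fun j => hg.X_mul_divided_succ n j)
  have h2 : ∀ u v : Fin r → (Tate F s)[X], delta1 (φ.iota fun j => u j + v j) =
      delta1 (φ.iota u) + delta1 (φ.iota v) := fun u v => by
    rw [← delta1_add, ← iota_add]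
    rfl
  rw [h2, h2, iota_X_mul, delta1_mul_starMap,
    φ.iota_sigmaPoly_mul_Phi hA fun i => Polynomial.C (PowerSeries.coeff n (g i)),
    delta1_gen_mul] at h1
  exact add_right_cancel h1

/-- Evaluating the first entry of the division identity at θ removes Φ and leaves a recursion that
telescopes to partial sums of the evaluation of g. -/
theorem IsSolution.theta_pow_mul_eval_divided (hg : φ.IsSolution h g) (n : ℕ) :
    theta F s ^ n * (φ.divided h g n ⟨0, φ.rank_pos⟩).eval (theta F s) =
      (h ⟨0, φ.rank_pos⟩).eval (theta F s) +
        ∑ k ∈ Finset.range n, PowerSeries.coeff k (g ⟨0, φ.rank_pos⟩) * theta F s ^ k := by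
  induction n with
  | zero => rw [divided_zero]; simp
  | succ n ih =>
    have h1 := congrArg (Polynomial.eval (theta F s))
      (hg.X_mul_divided_succ n ⟨0, φ.rank_pos⟩)
    rw [Polynomial.eval_add, Polynomial.eval_add, Polynomial.eval_finsetSum, Polynomial.eval_C,
      Finset.sum_eq_zero fun i _ => by
        rw [Polynomial.eval_mul, eval_theta_Phi_zero, mul_zero], add_zero, Polynomial.eval_mul,
      Polynomial.eval_X] at h1
    rw [pow_succ, mul_assoc, h1, mul_add, ih, Finset.sum_range_succ]
    ring

variable (φ h g) in
-- Beyond the degree of h only the correction constants survive, and they sit in the first entry,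
-- where δ_0 and δ_1 agree. This links the δ_1-tower to the limit defining ξ.
theorem eventually_delta1_iota_divided :
    ∀ᶠ n in atTop, delta1 (φ.iota (φ.divided h g n)) =
      (φ.divided h g n ⟨0, φ.rank_pos⟩).eval (theta F s) := by
  have hdiv : ∀ᶠ n in atTop, ∀ j, Polynomial.divX^[n] (h j) = 0 := by
    refine eventually_all.2 fun j => ?_
    filter_upwards [eventually_gt_atTop (h j).natDegree] with n hn
    ext k
    rw [coeff_divX_iterate, Polynomial.coeff_eq_zero_of_natDegree_lt (by omega),
      Polynomial.coeff_zero]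
  filter_upwards [hdiv] with n hn
  have hC : ∀ j, φ.divided h g n j =
      Polynomial.C (-∑ i, twist (-1) (prevCoeff g i n) * (φ.Phi i j).coeff 1) := fun j => by
    rw [divided, hn j, zero_sub, map_neg]
  rw [φ.delta1_iota_const _ _ (hC _), hC, Polynomial.eval_C]
  intro j hj
  rw [hC, Finset.sum_eq_zero fun i _ => by rw [φ.coeff_one_Phi hj, mul_zero], neg_zero, map_zero]

end Division

/-- `exp_φ(D_0(g + h)) = δ_1(ι(h))` whenever `g^{(-1)} Φ - g = h`. -/
theorem IsSolution.exp_D0 {r : ℕ} {φ : DrinfeldModule F s r} {h : Fin r → (Tate F s)[X]}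
    {g : Fin r → tateDisk F s} (hsol : φ.IsSolution h fun j => (g j).1) (hA : IsUnit (φ.A r)) :
    φ.exp (φ.D0 (g + vecToDisk h)) = delta1 (φ.iota h) := by
  set ξ := φ.D0 (g + vecToDisk h) with hξ
  set d : ℕ → Tate F s := fun n => delta1 (φ.iota (φ.divided h (fun j => (g j).1) n)) with hd
  have hξ' : ξ = (h ⟨0, φ.rank_pos⟩).eval (theta F s) + evalDisk (g ⟨0, φ.rank_pos⟩) := by
    rw [hξ, φ.D0_eq, Pi.add_apply, map_add, add_comm, vecToDisk, evalDisk_polyToDisk]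
  have hdlim : Tendsto (fun n => theta F s ^ n * d n) atTop (𝓝 ξ) := by
    rw [hξ']
    refine ((hasSum_evalDisk (g ⟨0, φ.rank_pos⟩)).tendsto_sum_nat.const_add _).congr' ?_
    filter_upwards [φ.eventually_delta1_iota_divided h fun j => (g j).1] with n hn
    rw [hd]
    dsimp only
    rw [hn, hsol.theta_pow_mul_eval_divided]
  -- Both exp_φ(θ^{-n} ξ) and d_n are φ_θ-towers asymptotic to θ^{-n} ξ; their difference is zero,
  -- and its value at n = 0 is the claim.
  have hzero := φ.eq_zero_of_phiAct_tower (fun n => φ.exp (thetaInv F s ^ n * ξ) - d n)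
    (fun n => by
      rw [map_sub, ← φ.exp_theta_mul, hd]
      dsimp only
      rw [hsol.delta1_iota_divided hA, pow_succ', ← mul_assoc, ← mul_assoc, theta_mul_thetaInv,
        one_mul])
    (by
      have h1 := (φ.exp_approx ξ).sub hdlim
      rw [sub_self] at h1
      exact h1.congr fun n => (mul_sub _ _ _).symm) 0
  rw [pow_zero, one_mul, sub_eq_zero] at hzero
  rw [hzero, hd]
  dsimp only
  rw [DrinfeldModule.divided_zero]

end DrinfeldModule

end DrinfeldTate
end

theorem theorem4 {F : Type*} [Field F] [Fintype F] {s r : ℕ} (φ : DrinfeldModule F s r)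
    (hA : IsUnit (φ.A r)) (h : Fin r → (Tate F s)[X]) (g : Fin r → tateDisk F s)
    (hg : Matrix.vecMul
          (fun j => PowerSeries.map
            ((twist (-1) : Tate F s ≃+* Tate F s) : Tate F s →+* Tate F s) (g j).1)
          (φ.Phi.map fun p => (p : PowerSeries (Tate F s))) - (fun j => (g j).1) =
      fun j => (h j : PowerSeries (Tate F s))) :
    Tendsto (fun k => delta0 (φ.iota k)) (comap vecToDisk (𝓝 (g + vecToDisk h)))
        (𝓝 (φ.D0 (g + vecToDisk h))) ∧
    Summable (fun i : ℕ => φ.expCoeff i * twist (i : ℤ) (φ.D0 (g + vecToDisk h))) ∧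
    φ.exp (φ.D0 (g + vecToDisk h)) = delta1 (φ.iota h) := by
  have hsol : φ.IsSolution h fun j => (g j).1 := hg
  refine ⟨?_, φ.summable_exp _, hsol.exp_D0 hA⟩
  rw [φ.D0_eq]
  exact φ.tendsto_delta0_iota _
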